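/- Let $P$ be a smooth ($C^\infty$, finite-dimensional, Hausdorff, second countable, without boundary) manifold. Equip $TP\oplus T^*P$ with the symmetric pairing $\langle (X,\alpha),(Y,\beta)\rangle=\alpha(Y)+\beta(X)$. An \emph{almost Dirac structure} on $P$ is a smooth vector subbundle $L\subset TP\oplus T^*P$ that is maximal isotropic, i.e. for every $x\in P$ the fibre $L_x$ is a maximal element among the isotropic subspaces of $T_xP\oplus T_x^*P$. It is \emph{regular} if the distribution $pr_1(L)\subset TP$ (the image of $L$ under the projection to $TP$) has constant rank. A distribution $F$ is \emph{integrable} if $P$ can be decomposed into leaves, i.e. partitioned into connected immersed submanifolds $\mathcal O$ such that $T_x\mathcal O=F_x$ for every $x\in\mathcal O$. For a smooth closed $3$-form $\phi$, the \emph{$\phi$-twisted Courant bracket} of smooth sections of $TP\oplus T^*P$ is $$[\![(X,\alpha),(Y,\beta)]\!]_\phi=\bigl([X,Y],\ \pounds_X\beta-\mathbf i_Y\,d\alpha+\mathbf i_{X\wedge Y}\phi\bigr),\qquad \mathbf i_{X\wedge Y}\phi=\phi(X,Y,\cdot\,),$$ and $L$ is a \emph{$\phi$-twisted Dirac structure}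 if it is an almost Dirac structure and $[\![\Gamma(L),\Gamma(L)]\!]_\phi\subseteq\Gamma(L)$, where $\Gamma(L)$ is the space of smooth sections of $L$. \textbf{Theorem.} Let $L\subset TP\oplus T^*P$ be a regular almost Dirac structure such that $pr_1(L)\subset TP$ is an integrable distribution. Then there exist a smooth $2$-form $\Omega$ on $P$ and an exact $3$-form $\phi=d\Omega$ with respect to which $L$ is a $\phi$-twisted Dirac structure. -/

import Mathlib

open Bundle Set Function
open scoped Manifold ContDiff Topology Bundle

noncomputable section

namespace DiracGeometry

universe uE uP

variable {E : Type uE} [NormedAddCommGroup E] [NormedSpace ℝ E]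
  {P : Type uP} [TopologicalSpace P] [ChartedSpace E P]

/-! ## Differential forms -/

variable (E P) in
/-- Vector fields on `P` (not necessarily smooth). -/
abbrev VField : Type _ := ∀ x : P, TangentSpace 𝓘(ℝ, E) x

variable (E) in
/-- The cotangent space `T*_x P`. -/
abbrev CotangentSpace (x : P) : Type _ := TangentSpace 𝓘(ℝ, E) x →L[ℝ] ℝ

variable (E P) in
/-- `1`-forms on `P` as sections of the cotangent bundle (not necessarily smooth). -/
abbrev CovField : Type _ := ∀ x : P, CotangentSpace E x

variable (E P) in
/-- Differential `k`-forms on `P` (not necessarily smooth). -/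
abbrev DForm (k : ℕ) : Type _ := ∀ x : P, (TangentSpace 𝓘(ℝ, E) x) [⋀^Fin k]→L[ℝ] ℝ

/-- The local representative of the `k`-form `η` in the preferred chart at `x₀`: the pullback of `η`
by the inverse of that chart. It is meaningful on the (open) target of the chart. -/
def chartRep {k : ℕ} (η : DForm E P k) (x₀ : P) : E → E [⋀^Fin k]→L[ℝ] ℝ :=
  fun y => (η ((extChartAt 𝓘(ℝ, E) x₀).symm y)).compContinuousLinearMap
    (mfderiv 𝓘(ℝ, E) 𝓘(ℝ, E) (extChartAt 𝓘(ℝ, E) x₀).symm y)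

/-- A form is smooth if its local representatives are smooth. -/
def SmoothForm {k : ℕ} (η : DForm E P k) : Prop :=
  ∀ x₀ : P, ContDiffOn ℝ ∞ (chartRep η x₀) (extChartAt 𝓘(ℝ, E) x₀).target

/-- The exterior derivative of a form: at each point, the exterior derivative of the local
representative in the chart at this point, pulled back by the chart. -/
def extD {k : ℕ} (η : DForm E P k) : DForm E P (k + 1) :=
  fun x => (extDeriv (chartRep η x) (extChartAt 𝓘(ℝ, E) x x)).compContinuousLinearMap
    (mfderiv 𝓘(ℝ, E) 𝓘(ℝ, E) (extChartAt 𝓘(ℝ, E) x) x)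

/-- A section of the cotangent bundle seen as a differential form of degree `1`. -/
def toForm (α : CovField E P) : DForm E P 1 :=
  fun x => ContinuousAlternatingMap.ofSubsingleton ℝ (TangentSpace 𝓘(ℝ, E) x) ℝ (0 : Fin 1) (α x)

/-- `i_u η = η(u, ·)` for a `2`-form `η` at a point `x`. -/
def contract₁ {x : P} (u : TangentSpace 𝓘(ℝ, E) x)
    (η : (TangentSpace 𝓘(ℝ, E) x) [⋀^Fin 2]→L[ℝ] ℝ) : CotangentSpace E x :=
  (ContinuousAlternatingMap.ofSubsingleton ℝ E ℝ (0 : Fin 1)).symm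
    (ContinuousAlternatingMap.curryLeft (E := E) η u)

/-- `i_{u ∧ v} φ = φ(u, v, ·)` for a `3`-form `φ` at a point `x`. -/
def contract₂ {x : P} (u v : TangentSpace 𝓘(ℝ, E) x)
    (φ : (TangentSpace 𝓘(ℝ, E) x) [⋀^Fin 3]→L[ℝ] ℝ) : CotangentSpace E x :=
  contract₁ v (ContinuousAlternatingMap.curryLeft (E := E) φ u)

theorem toForm_apply (α : CovField E P) (x : P) (v : Fin 1 → TangentSpace 𝓘(ℝ, E) x) :
    toForm α x v = α x (v 0) := rfl

theorem contract₁_apply {x : P} (u w : TangentSpace 𝓘(ℝ, E) x)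
    (η : (TangentSpace 𝓘(ℝ, E) x) [⋀^Fin 2]→L[ℝ] ℝ) :
    contract₁ u η w = η ![u, w] := by
  change η (Matrix.vecCons u (fun _ => w)) = _
  congr 1; ext i; fin_cases i <;> rfl

theorem contract₂_apply {x : P} (u v w : TangentSpace 𝓘(ℝ, E) x)
    (φ : (TangentSpace 𝓘(ℝ, E) x) [⋀^Fin 3]→L[ℝ] ℝ) :
    contract₂ u v φ w = φ ![u, v, w] := by
  refine (contract₁_apply v w _).trans ?_
  rfl

/-- The Lie derivative `£_X β = d(β(X)) + i_X dβ` of a `1`-form `β`. -/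
def lieDer (X : VField E P) (β : CovField E P) : CovField E P :=
  fun x => mvfderiv 𝓘(ℝ, E) (fun y => β y (X y)) x + contract₁ (X x) (extD (toForm β) x)

/-! ## The Whitney sum `TP ⊕ T*P` -/

variable (E) in
/-- The fibre `T_x P ⊕ T*_x P`. -/
abbrev Pontryagin (x : P) : Type _ := TangentSpace 𝓘(ℝ, E) x × CotangentSpace E x

variable (E P) in
/-- Sections of `TP ⊕ T*P` (not necessarily smooth). -/
abbrev PSection : Type _ := ∀ x : P, Pontryagin E x

variable (E P) in
/-- Families of subspaces `L_x ⊆ T_x P ⊕ T*_x P`. -/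
abbrev PFamily : Type _ := ∀ x : P, Submodule ℝ (Pontryagin E x)

/-- Smoothness on a set of a section of the vector bundle `TP ⊕ T*P`. -/
def SmoothSectionOn [IsManifold 𝓘(ℝ, E) ∞ P] (σ : PSection E P) (U : Set P) : Prop :=
  ContMDiffOn 𝓘(ℝ, E) (𝓘(ℝ, E).prod 𝓘(ℝ, E × (E →L[ℝ] ℝ))) ∞
    (fun x => TotalSpace.mk' (E × (E →L[ℝ] ℝ)) (E := fun x : P => Pontryagin E x) x (σ x)) U

/-- `L` is a smooth vector subbundle of `TP ⊕ T*P`: near each point it is spanned by a smooth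
frame. -/
def IsSubbundle [IsManifold 𝓘(ℝ, E) ∞ P] (L : PFamily E P) : Prop :=
  ∀ x₀ : P, ∃ U : Set P, IsOpen U ∧ x₀ ∈ U ∧ ∃ (k : ℕ) (s : Fin k → PSection E P),
    (∀ i, SmoothSectionOn (s i) U) ∧
    ∀ x ∈ U, LinearIndependent ℝ (fun i => s i x) ∧
      Submodule.span ℝ (range fun i => s i x) = L x

/-- The space `Γ(L)` of smooth global sections of `TP ⊕ T*P` with values in `L`. -/
def Gam [IsManifold 𝓘(ℝ, E) ∞ P] (L : PFamily E P) : Set (PSection E P) :=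
  {σ | SmoothSectionOn σ univ ∧ ∀ x, σ x ∈ L x}

/-- The pairing `⟨(X, α), (Y, β)⟩ = α(Y) + β(X)`. -/
def pairing {x : P} (a b : Pontryagin E x) : ℝ := a.2 b.1 + b.2 a.1

/-- Isotropic subspaces of `T_x P ⊕ T*_x P`. -/
def IsIsotropic {x : P} (S : Submodule ℝ (Pontryagin E x)) : Prop :=
  ∀ a ∈ S, ∀ b ∈ S, pairing a b = 0

/-- Almost Dirac structures: maximal isotropic subbundles of `TP ⊕ T*P`. -/
structure IsAlmostDirac [IsManifold 𝓘(ℝ, E) ∞ P] (L : PFamily E P) : Prop where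
  subbundle : IsSubbundle L
  maximal_isotropic : ∀ x, Maximal IsIsotropic (L x)

/-- The `φ`-twisted Courant bracket
`⟦(X, α), (Y, β)⟧_φ = ([X, Y], £_X β - i_Y dα + i_{X ∧ Y} φ)`. -/
def courant (φ : DForm E P 3) (σ τ : PSection E P) : PSection E P :=
  fun x =>
    (VectorField.mlieBracket 𝓘(ℝ, E) (fun y => (σ y).1) (fun y => (τ y).1) x,
      lieDer (fun y => (σ y).1) (fun y => (τ y).2) x
        - contract₁ (τ x).1 (extD (toForm fun y => (σ y).2) x)
        + contract₂ (σ x).1 (τ x).1 (φ x))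

/-- `L` is a `φ`-twisted Dirac structure, where `φ` is a smooth closed `3`-form. -/
structure IsTwistedDirac [IsManifold 𝓘(ℝ, E) ∞ P] (φ : DForm E P 3) (L : PFamily E P) :
    Prop where
  smooth : SmoothForm φ
  closed : extD φ = 0
  almostDirac : IsAlmostDirac L
  courant_mem : ∀ σ ∈ Gam L, ∀ τ ∈ Gam L, courant φ σ τ ∈ Gam L

/-- A form of degree `k + 1` is exact if it is the exterior derivative of a smooth `k`-form. -/
def IsExactForm {k : ℕ} (φ : DForm E P (k + 1)) : Prop :=
  ∃ Om : DForm E P k, SmoothForm Om ∧ extD Om = φ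

/-! ## Distributions -/

variable (E P) in
/-- Distributions: families of subspaces `F_x ⊆ T_x P`. -/
abbrev Distrib : Type _ := ∀ x : P, Submodule ℝ (TangentSpace 𝓘(ℝ, E) x)

/-- The distribution `pr₁(L)`. -/
def pr₁ (L : PFamily E P) : Distrib E P :=
  fun x => (L x).map (LinearMap.fst ℝ (TangentSpace 𝓘(ℝ, E) x) (CotangentSpace E x))

/-- The distribution has constant rank. -/
def ConstantRank (F : Distrib E P) : Prop :=
  ∃ r : ℕ, ∀ x, Module.finrank ℝ (F x) = r

/-- `O` is a connected immersed submanifold of `P` (the image of a connected smooth manifold `N`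
under an injective immersion `j`) with `T_x O = F_x` for all `x ∈ O`. -/
def IsIntegralSubmanifold (F : Distrib E P) (O : Set P) : Prop :=
  ∃ (r : ℕ) (N : Type uP) (_ : TopologicalSpace N) (_ : ChartedSpace (EuclideanSpace ℝ (Fin r)) N)
    (j : N → P),
    IsManifold (𝓡 r) ∞ N ∧ ConnectedSpace N ∧
    Injective j ∧ range j = O ∧ ContMDiff (𝓡 r) 𝓘(ℝ, E) ∞ j ∧
    ∀ y : N, Injective (mfderiv (𝓡 r) 𝓘(ℝ, E) j y) ∧
      (mfderiv (𝓡 r) 𝓘(ℝ, E) j y).range = F (j y)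

/-- The distribution `F` is integrable: `P` can be decomposed into leaves `O` such that
`T_x O = F_x` for every `x ∈ O`. -/
def IsIntegrable (F : Distrib E P) : Prop :=
  ∃ leaves : Set (Set P), Setoid.IsPartition leaves ∧ ∀ O ∈ leaves, IsIntegralSubmanifold F O

end DiracGeometry

end

/-! Write F for pr₁(L). Isotropy makes ω(X, Y) = α(Y), for (X, α) and (Y, β) in L, a well-defined
alternating form on F (`linearCombination_eq_of_mem`). Constant rank makes it extend smoothly near
each point (`exists_local_extendingForms`). The bilinear extensions at a point form a convex set, so
a partition of unity glues them, and the alternating part of the result is a smooth two-form Om on P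
that restricts to ω. Every (X, α) in L thus satisfies α = i_X Om on F.

For sections (X, α), (Y, β), (Z, γ) of L, the brackets of X, Y, Z lie in F, because F is tangent to
leaves (`mlieBracket_mem_of_isIntegrable`). Hence α, β, γ may be replaced by contractions of Om
wherever they are evaluated on these fields and their brackets, and the pairing of the untwisted
Courant bracket of the first two sections with the third becomes Cartan's formula for dOm(X, Y, Z)
(`courant_pairing_eq_extDeriv`). The twist adds φ(X, Y, Z), so φ = -dOm makes the bracket orthogonal
to L. Its vector part lies in F, so maximality puts it in L (`mem_of_pairing_eq_zero`). The required
form is therefore Ω = -Om.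

The analysis takes place in charts: forms, fields and brackets are transported to E, where the
identities are proved. -/

noncomputable section

namespace DiracGeometry

universe uE uP

/-! ### Lie brackets and exterior derivatives in a vector space -/

section VectorSpace

open VectorField

variable {E : Type*} [NormedAddCommGroup E] [NormedSpace ℝ E]
  {V : Type*} [NormedAddCommGroup V] [NormedSpace ℝ V] [FiniteDimensional ℝ V]
  {M : Type*} [NormedAddCommGroup M] [NormedSpace ℝ M]

/-- If A is a left inverse of G(y₀), then A G(y) is invertible for y near y₀, and θ(y) = (A G(y))⁻¹
A works there, as smooth as G because inversion is smooth. -/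
theorem exists_contDiffAt_leftInverse [FiniteDimensional ℝ E] {n : WithTop ℕ∞}
    {G : M → V →L[ℝ] E} {y₀ : M} (hG : ContinuousAt G y₀) (hinj : Injective (G y₀)) :
    ∃ θ : M → E →L[ℝ] V, ∀ᶠ y in 𝓝 y₀, (ContDiffAt ℝ n G y → ContDiffAt ℝ n θ y) ∧
      (θ y).comp (G y) = ContinuousLinearMap.id ℝ V := by
  obtain ⟨A', hA'⟩ := (G y₀ : V →ₗ[ℝ] E).exists_leftInverse_of_injective
    (LinearMap.ker_eq_bot.2 hinj)
  set A : E →L[ℝ] V := LinearMap.toContinuousLinearMap A'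
  have hA : A.comp (G y₀) = ContinuousLinearMap.id ℝ V := by
    ext v
    exact LinearMap.congr_fun hA' v
  have hunit : IsUnit (A.comp (G y₀)) := hA ▸ isUnit_one
  have hcont : ContinuousAt (fun y => A.comp (G y)) y₀ := continuousAt_const.clm_comp hG
  have hopen : ∀ᶠ y in 𝓝 y₀, IsUnit (A.comp (G y)) :=
    hcont.eventually (Units.isOpen.mem_nhds hunit)
  refine ⟨fun y => (Ring.inverse (A.comp (G y))).comp A, ?_⟩
  filter_upwards [hopen] with y hy
  refine ⟨fun hGy => ContDiffAt.clm_comp ?_ contDiffAt_const, ?_⟩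
  · obtain ⟨u, hu⟩ := hy
    have h := contDiffAt_ringInverse ℝ (R := V →L[ℝ] V) (n := n) u
    rw [hu] at h
    exact ContDiffAt.comp (g := Ring.inverse) y h (contDiffAt_const.clm_comp hGy)
  · rw [ContinuousLinearMap.comp_assoc]
    exact Ring.inverse_mul_cancel _ hy

/-- Vector fields tangent to the image of an immersion have a tangent Lie bracket. -/
theorem lieBracket_mem_range_fderiv [FiniteDimensional ℝ E] {j : V → E} {v : V} (hj : ContDiffAt ℝ ∞ j v)
    (hinj : Injective (fderiv ℝ j v)) {X Y : E → E}
    (hX : ContDiffAt ℝ ∞ X (j v)) (hY : ContDiffAt ℝ ∞ Y (j v))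
    (hXj : ∀ᶠ w in 𝓝 v, X (j w) ∈ (fderiv ℝ j w).range)
    (hYj : ∀ᶠ w in 𝓝 v, Y (j w) ∈ (fderiv ℝ j w).range) :
    lieBracket ℝ X Y (j v) ∈ (fderiv ℝ j v).range := by
  have hDj : ContDiffAt ℝ ∞ (fderiv ℝ j) v := hj.fderiv_right (m := ∞) (by simp)
  obtain ⟨θ, hθe⟩ := exists_contDiffAt_leftInverse (n := ∞) hDj.continuousAt hinj
  have hθ : ContDiffAt ℝ ∞ θ v := hθe.self_of_nhds.1 hDj
  have hθj := hθe.mono fun _ h => h.2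
  have key : ∀ Z : E → E, ContDiffAt ℝ ∞ Z (j v) →
      (∀ᶠ w in 𝓝 v, Z (j w) ∈ (fderiv ℝ j w).range) →
      ∃ a : V → V, DifferentiableAt ℝ a v ∧ Z (j v) = fderiv ℝ j v (a v) ∧
        ∀ h, fderiv ℝ Z (j v) (fderiv ℝ j v h) =
          fderiv ℝ (fderiv ℝ j) v h (a v) + fderiv ℝ j v (fderiv ℝ a v h) := by
    -- A field tangent along j has the form Z ∘ j = Dj(a) with a = θ(Z ∘ j). Both sides are then
    -- differentiated at v.
    intro Z hZ hZj
    have hZc : ContDiffAt ℝ ∞ (fun w => Z (j w)) v := ContDiffAt.comp v hZ hj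
    have ha : DifferentiableAt ℝ (fun w => θ w (Z (j w))) v :=
      (hθ.clm_apply hZc).differentiableAt (by simp)
    have heq : (fun w => Z (j w)) =ᶠ[𝓝 v] fun w => fderiv ℝ j w (θ w (Z (j w))) := by
      filter_upwards [hθj, hZj] with w hw hZw
      obtain ⟨u, hu⟩ := hZw
      have hu : fderiv ℝ j w u = Z (j w) := hu
      have := DFunLike.congr_fun hw u
      simp only [ContinuousLinearMap.comp_apply, ContinuousLinearMap.id_apply] at this
      rw [← hu, this]
    refine ⟨_, ha, heq.self_of_nhds, fun h => ?_⟩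
    have h1 := heq.fderiv_eq (𝕜 := ℝ)
    have h2 : fderiv ℝ (fun w => Z (j w)) v = (fderiv ℝ Z (j v)).comp (fderiv ℝ j v) :=
      ((hZ.differentiableAt (by simp)).hasFDerivAt.comp v
        (hj.differentiableAt (by simp)).hasFDerivAt).fderiv
    rw [fderiv_clm_apply (hDj.differentiableAt (by simp)) ha, h2] at h1
    have := DFunLike.congr_fun h1 h
    simpa [add_comm] using this
  obtain ⟨a, -, hXa, hDX⟩ := key X hX hXj
  obtain ⟨b, -, hYb, hDY⟩ := key Y hY hYj
  -- The preimage is the bracket of a and b upstairs; the terms in D²j cancel by symmetry.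
  refine ⟨fderiv ℝ b v (a v) - fderiv ℝ a v (b v), ?_⟩
  have hsymm : IsSymmSndFDerivAt ℝ j v := hj.isSymmSndFDerivAt (by simpa using ENat.LEInfty.out)
  change fderiv ℝ j v _ = _
  rw [lieBracket_eq]
  simp only [hXa, hYb, hDX, hDY, map_sub, hsymm.eq (a v) (b v)]
  abel

theorem extDeriv_ofSubsingleton_apply {b : E → E →L[ℝ] ℝ} {y : E} (hb : DifferentiableAt ℝ b y)
    {U W : E → E} (hU : DifferentiableAt ℝ U y) (hW : DifferentiableAt ℝ W y) :
    extDeriv (fun z => ContinuousAlternatingMap.ofSubsingleton ℝ E ℝ (0 : Fin 1) (b z)) y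
        ![U y, W y] =
      fderiv ℝ (fun z => b z (W z)) y (U y) - fderiv ℝ (fun z => b z (U z)) y (W y) -
        b y (lieBracket ℝ U W y) := by
  have hd : DifferentiableAt ℝ
      (fun z => ContinuousAlternatingMap.ofSubsingleton ℝ E ℝ (0 : Fin 1) (b z)) y :=
    (ContinuousAlternatingMap.ofSubsingletonLIE (𝕜 := ℝ) (E := E) (F := ℝ)
      (0 : Fin 1)).differentiableAt.comp y hb
  have h := extDeriv_apply_vectorField (V := ![U, W]) hd
    (by intro i; fin_cases i; exacts [hU, hW])
  have e : (fun i => (![U, W] : Fin 2 → E → E) i y) = ![U y, W y] := by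
    ext i; fin_cases i <;> rfl
  rw [e] at h
  rw [h]
  simp [Fin.sum_univ_two, Fin.removeNth, sub_eq_add_neg]

theorem extDeriv_two_apply {Om : E → E [⋀^Fin 2]→L[ℝ] ℝ} {y : E} (hOm : DifferentiableAt ℝ Om y)
    {X Y Z : E → E} (hX : DifferentiableAt ℝ X y) (hY : DifferentiableAt ℝ Y y)
    (hZ : DifferentiableAt ℝ Z y) :
    extDeriv Om y ![X y, Y y, Z y] =
      fderiv ℝ (fun z => Om z ![Y z, Z z]) y (X y) - fderiv ℝ (fun z => Om z ![X z, Z z]) y (Y y)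
        + fderiv ℝ (fun z => Om z ![X z, Y z]) y (Z y)
        - Om y ![lieBracket ℝ X Y y, Z y] + Om y ![lieBracket ℝ X Z y, Y y]
        - Om y ![lieBracket ℝ Y Z y, X y] := by
  have h : extDeriv Om y (fun i => (![X, Y, Z] : Fin 3 → E → E) i y) =
      (∑ i : Fin 3, (-1) ^ i.val • fderiv ℝ
        (fun z => Om z (i.removeNth (fun k => (![X, Y, Z] : Fin 3 → E → E) k z))) y
          ((![X, Y, Z] : Fin 3 → E → E) i y)) -
      ∑ i : Fin 2, ∑ j ∈ Finset.Ici i, (-1) ^ (i + j : ℕ) •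
        Om y (Matrix.vecCons (lieBracket ℝ ((![X, Y, Z] : Fin 3 → E → E) i.castSucc)
          ((![X, Y, Z] : Fin 3 → E → E) j.succ) y) (j.removeNth (i.castSucc.removeNth
            (fun k => (![X, Y, Z] : Fin 3 → E → E) k y)))) :=
    extDeriv_apply_vectorField (V := ![X, Y, Z]) hOm
    (by intro i; fin_cases i; exacts [hX, hY, hZ])
  have e : (fun i => (![X, Y, Z] : Fin 3 → E → E) i y) = ![X y, Y y, Z y] := by
    ext i; fin_cases i <;> rfl
  have e0 : ∀ z, (0 : Fin 3).removeNth (fun i => (![X, Y, Z] : Fin 3 → E → E) i z) =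
      ![Y z, Z z] := by
    intro z; ext i; fin_cases i <;> rfl
  have e1 : ∀ z, (1 : Fin 3).removeNth (fun i => (![X, Y, Z] : Fin 3 → E → E) i z) =
      ![X z, Z z] := by
    intro z; ext i; fin_cases i <;> rfl
  have e2 : ∀ z, (2 : Fin 3).removeNth (fun i => (![X, Y, Z] : Fin 3 → E → E) i z) =
      ![X z, Y z] := by
    intro z; ext i; fin_cases i <;> rfl
  have f00 : (0 : Fin 2).removeNth ![Y y, Z y] = ![Z y] := by ext i; fin_cases i; rfl
  have f10 : (1 : Fin 2).removeNth ![Y y, Z y] = ![Y y] := by ext i; fin_cases i; rfl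
  have f11 : (1 : Fin 2).removeNth ((1 : Fin 3).removeNth ![X y, Y y, Z y]) = ![X y] := by
    ext i; fin_cases i; rfl
  have i0 : Finset.Ici (0 : Fin 2) = {0, 1} := by decide
  have i1 : Finset.Ici (1 : Fin 2) = {1} := by decide
  rw [e] at h
  rw [h]
  simp only [Fin.sum_univ_three, Fin.sum_univ_two, e0, e1, e2]
  simp [i0, i1, f00, f10, f11]
  ring

/-- The pairing of the untwisted Courant bracket of two sections with a third one, when all of
them lie in the graph of the restriction of a two-form to an involutive distribution. -/
theorem courant_pairing_eq_extDeriv {Om : E → E [⋀^Fin 2]→L[ℝ] ℝ} {y : E}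
    (hOm : DifferentiableAt ℝ Om y) {X Y Z : E → E} (hX : DifferentiableAt ℝ X y)
    (hY : DifferentiableAt ℝ Y y) (hZ : DifferentiableAt ℝ Z y) {a b : E → E →L[ℝ] ℝ}
    {c : E →L[ℝ] ℝ} (ha : DifferentiableAt ℝ a y) (hb : DifferentiableAt ℝ b y)
    (hbZ : ∀ᶠ z in 𝓝 y, b z (Z z) = Om z ![Y z, Z z])
    (haY : ∀ᶠ z in 𝓝 y, a z (Y z) = Om z ![X z, Y z])
    (haZ : ∀ᶠ z in 𝓝 y, a z (Z z) = Om z ![X z, Z z])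
    (hbXZ : b y (lieBracket ℝ X Z y) = Om y ![Y y, lieBracket ℝ X Z y])
    (haYZ : a y (lieBracket ℝ Y Z y) = Om y ![X y, lieBracket ℝ Y Z y])
    (hcXY : c (lieBracket ℝ X Y y) = Om y ![Z y, lieBracket ℝ X Y y]) :
    fderiv ℝ (fun z => b z (X z)) y (Z y)
      + extDeriv (fun z => ContinuousAlternatingMap.ofSubsingleton ℝ E ℝ (0 : Fin 1) (b z)) y
          ![X y, Z y]
      - extDeriv (fun z => ContinuousAlternatingMap.ofSubsingleton ℝ E ℝ (0 : Fin 1) (a z)) y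
          ![Y y, Z y]
      + c (lieBracket ℝ X Y y) = extDeriv Om y ![X y, Y y, Z y] := by
  have swap : ∀ (η : E [⋀^Fin 2]→L[ℝ] ℝ) (u w : E), η ![u, w] = - η ![w, u] := by
    intro η u w
    have h := η.toAlternatingMap.map_swap ![w, u] (i := 0) (j := 1) (by decide)
    have e : (![w, u] ∘ Equiv.swap (0 : Fin 2) 1) = ![u, w] := by
      ext i; fin_cases i <;> simp
    rw [e] at h
    exact h
  -- The derivative of b(X) along Z cancels against the same term in db(X, Z). What remains is
  -- Cartan's formula for dOm. The differentiated terms need the graph equations on a neighbourhood,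
  -- the bracket terms only at y.
  rw [extDeriv_ofSubsingleton_apply hb hX hZ, extDeriv_ofSubsingleton_apply ha hY hZ,
    extDeriv_two_apply hOm hX hY hZ, hbXZ, haYZ, hcXY,
    Filter.EventuallyEq.fderiv_eq (f₁ := fun z => b z (Z z)) hbZ,
    Filter.EventuallyEq.fderiv_eq (f₁ := fun z => a z (Z z)) haZ,
    Filter.EventuallyEq.fderiv_eq (f₁ := fun z => a z (Y z)) haY,
    swap (Om y) (lieBracket ℝ X Y y), swap (Om y) (lieBracket ℝ X Z y),
    swap (Om y) (lieBracket ℝ Y Z y)]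
  ring

end VectorSpace

/-! ### Local representatives and smoothness of sections -/

section Charts

variable {E : Type uE} [NormedAddCommGroup E] [NormedSpace ℝ E]
  {P : Type uP} [TopologicalSpace P] [ChartedSpace E P]

/-- The local representative of a vector field in the preferred chart at `x₀`. -/
def vecRep (X : VField E P) (x₀ : P) (y : E) : E :=
  mfderiv 𝓘(ℝ, E) 𝓘(ℝ, E) (extChartAt 𝓘(ℝ, E) x₀) ((extChartAt 𝓘(ℝ, E) x₀).symm y)
    (X ((extChartAt 𝓘(ℝ, E) x₀).symm y))

/-- The local representative of a `1`-form in the preferred chart at `x₀`. -/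
def covRep (α : CovField E P) (x₀ : P) (y : E) : E →L[ℝ] ℝ :=
  (α ((extChartAt 𝓘(ℝ, E) x₀).symm y)).comp
    (mfderiv 𝓘(ℝ, E) 𝓘(ℝ, E) (extChartAt 𝓘(ℝ, E) x₀).symm y)

/-- Families of bilinear forms on the tangent spaces of `P`. -/
abbrev BilField (E : Type uE) [NormedAddCommGroup E] [NormedSpace ℝ E] (P : Type uP)
    [TopologicalSpace P] [ChartedSpace E P] : Type _ :=
  ∀ x : P, TangentSpace 𝓘(ℝ, E) x →L[ℝ] TangentSpace 𝓘(ℝ, E) x →L[ℝ] ℝ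

/-- The local representative of a field of bilinear forms in the preferred chart at `x₀`. -/
def bilRep (B : BilField E P) (x₀ : P) (y : E) : E →L[ℝ] E →L[ℝ] ℝ :=
  ContinuousLinearMap.bilinearComp (E := E) (F := E) (B ((extChartAt 𝓘(ℝ, E) x₀).symm y))
    (mfderiv 𝓘(ℝ, E) 𝓘(ℝ, E) (extChartAt 𝓘(ℝ, E) x₀).symm y)
    (mfderiv 𝓘(ℝ, E) 𝓘(ℝ, E) (extChartAt 𝓘(ℝ, E) x₀).symm y)

theorem isOpen_target (x₀ : P) : IsOpen (extChartAt 𝓘(ℝ, E) x₀).target :=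
  isOpen_extChartAt_target x₀

theorem symm_mem_chartAt_source {x₀ : P} {y : E} (hy : y ∈ (extChartAt 𝓘(ℝ, E) x₀).target) :
    (extChartAt 𝓘(ℝ, E) x₀).symm y ∈ (chartAt E x₀).source := by
  rw [← extChartAt_source 𝓘(ℝ, E)]
  exact (extChartAt 𝓘(ℝ, E) x₀).map_target hy

variable [IsManifold 𝓘(ℝ, E) ∞ P]

theorem isManifold_one : IsManifold 𝓘(ℝ, E) 1 P := IsManifold.of_le (n := ∞) (by simp)

theorem mfderiv_extChartAt_symm_apply {x₀ : P} {y : E} (hy : y ∈ (extChartAt 𝓘(ℝ, E) x₀).target)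
    (v : E) :
    mfderiv 𝓘(ℝ, E) 𝓘(ℝ, E) (extChartAt 𝓘(ℝ, E) x₀) ((extChartAt 𝓘(ℝ, E) x₀).symm y)
      (mfderiv 𝓘(ℝ, E) 𝓘(ℝ, E) (extChartAt 𝓘(ℝ, E) x₀).symm y v) = v := by
  have := isManifold_one (E := E) (P := P)
  have h := mfderiv_extChartAt_comp_mfderivWithin_extChartAt_symm (I := 𝓘(ℝ, E)) hy
  simp only [modelWithCornersSelf_coe, range_id, mfderivWithin_univ] at h
  exact DFunLike.congr_fun h v

theorem mfderiv_symm_extChartAt_apply {x₀ : P} {y : E} (hy : y ∈ (extChartAt 𝓘(ℝ, E) x₀).target)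
    (v : TangentSpace 𝓘(ℝ, E) ((extChartAt 𝓘(ℝ, E) x₀).symm y)) :
    mfderiv 𝓘(ℝ, E) 𝓘(ℝ, E) (extChartAt 𝓘(ℝ, E) x₀).symm y
      (mfderiv 𝓘(ℝ, E) 𝓘(ℝ, E) (extChartAt 𝓘(ℝ, E) x₀)
        ((extChartAt 𝓘(ℝ, E) x₀).symm y) v) = v := by
  have := isManifold_one (E := E) (P := P)
  have h := mfderivWithin_extChartAt_symm_comp_mfderiv_extChartAt (I := 𝓘(ℝ, E)) hy
  simp only [modelWithCornersSelf_coe, range_id, mfderivWithin_univ] at h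
  exact DFunLike.congr_fun h v

theorem contMDiffAt_iff_contDiffAt_comp_symm {W : Type*} [NormedAddCommGroup W] [NormedSpace ℝ W]
    {g : P → W} {x₀ : P} {y : E} (hy : y ∈ (extChartAt 𝓘(ℝ, E) x₀).target) :
    ContMDiffAt 𝓘(ℝ, E) 𝓘(ℝ, W) ∞ g ((extChartAt 𝓘(ℝ, E) x₀).symm y) ↔
      ContDiffAt ℝ ∞ (fun z => g ((extChartAt 𝓘(ℝ, E) x₀).symm z)) y := by
  have hx : (extChartAt 𝓘(ℝ, E) x₀).symm y ∈ (chartAt E x₀).source := by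
    rw [← extChartAt_source 𝓘(ℝ, E)]
    exact (extChartAt 𝓘(ℝ, E) x₀).map_target hy
  rw [contMDiffAt_iff_source_of_mem_source hx, (extChartAt 𝓘(ℝ, E) x₀).right_inv hy]
  simp only [modelWithCornersSelf_coe, range_id, contMDiffWithinAt_univ]
  exact contMDiffAt_iff_contDiffAt

theorem continuousLinearMapAt_symm {x₀ : P} {y : E}
    (hy : y ∈ (extChartAt 𝓘(ℝ, E) x₀).target) :
    (trivializationAt E (TangentSpace 𝓘(ℝ, E)) x₀).continuousLinearMapAt ℝ
      ((extChartAt 𝓘(ℝ, E) x₀).symm y) =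
    mfderiv 𝓘(ℝ, E) 𝓘(ℝ, E) (extChartAt 𝓘(ℝ, E) x₀) ((extChartAt 𝓘(ℝ, E) x₀).symm y) := by
  have := isManifold_one (E := E) (P := P)
  exact TangentBundle.continuousLinearMapAt_trivializationAt (symm_mem_chartAt_source hy)

theorem symmL_symm {x₀ : P} {y : E}
    (hy : y ∈ (extChartAt 𝓘(ℝ, E) x₀).target) :
    (trivializationAt E (TangentSpace 𝓘(ℝ, E)) x₀).symmL ℝ
      ((extChartAt 𝓘(ℝ, E) x₀).symm y) =
    mfderiv 𝓘(ℝ, E) 𝓘(ℝ, E) (extChartAt 𝓘(ℝ, E) x₀).symm y := by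
  have := isManifold_one (E := E) (P := P)
  rw [TangentBundle.symmL_trivializationAt (symm_mem_chartAt_source hy),
    (extChartAt 𝓘(ℝ, E) x₀).right_inv hy]
  simp only [modelWithCornersSelf_coe, range_id, mfderivWithin_univ]
  rfl

theorem trivializationAt_cotangent_apply {x₀ : P} {y : E}
    (hy : y ∈ (extChartAt 𝓘(ℝ, E) x₀).target)
    (a : CotangentSpace E ((extChartAt 𝓘(ℝ, E) x₀).symm y)) :
    (trivializationAt (E →L[ℝ] ℝ) (fun x : P => CotangentSpace E x) x₀
      ⟨(extChartAt 𝓘(ℝ, E) x₀).symm y, a⟩).2 =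
    a.comp (mfderiv 𝓘(ℝ, E) 𝓘(ℝ, E) (extChartAt 𝓘(ℝ, E) x₀).symm y) := by
  rw [← symmL_symm hy]
  change (Trivialization.continuousLinearMap (RingHom.id ℝ)
    (trivializationAt E (TangentSpace 𝓘(ℝ, E)) x₀) (trivializationAt ℝ (Bundle.Trivial P ℝ) x₀)
      ⟨(extChartAt 𝓘(ℝ, E) x₀).symm y, a⟩).2 = _
  rw [Trivialization.continuousLinearMap_apply]
  ext v
  refine (congrArg (fun l : ℝ →L[ℝ] ℝ => l _)
    (Bundle.Trivial.continuousLinearMapAt_trivialization ℝ P ℝ _)).trans ?_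
  rfl

theorem trivializationAt_pontryagin_apply {x₀ : P} {y : E}
    (hy : y ∈ (extChartAt 𝓘(ℝ, E) x₀).target)
    (a : Pontryagin E ((extChartAt 𝓘(ℝ, E) x₀).symm y)) :
    (trivializationAt (E × (E →L[ℝ] ℝ)) (fun x : P => Pontryagin E x) x₀
      ⟨(extChartAt 𝓘(ℝ, E) x₀).symm y, a⟩).2 =
    (mfderiv 𝓘(ℝ, E) 𝓘(ℝ, E) (extChartAt 𝓘(ℝ, E) x₀)
      ((extChartAt 𝓘(ℝ, E) x₀).symm y) a.1,
      a.2.comp (mfderiv 𝓘(ℝ, E) 𝓘(ℝ, E) (extChartAt 𝓘(ℝ, E) x₀).symm y)) := by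
  rw [← trivializationAt_cotangent_apply hy, ← continuousLinearMapAt_symm hy]
  refine Prod.ext ?_ rfl
  exact (congrFun (Trivialization.coe_linearMapAt_of_mem (R := ℝ)
    (trivializationAt E (TangentSpace 𝓘(ℝ, E)) x₀) (symm_mem_chartAt_source hy)) a.1).symm

theorem contDiffAt_congr_iff {W : Type*} [NormedAddCommGroup W] [NormedSpace ℝ W]
    {f g : E → W} {y : E} (h : f =ᶠ[𝓝 y] g) : ContDiffAt ℝ ∞ f y ↔ ContDiffAt ℝ ∞ g y :=
  ⟨fun hf => hf.congr_of_eventuallyEq h.symm, fun hg => hg.congr_of_eventuallyEq h⟩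

/-- The trivialization at x₀ acts on vectors by the derivative of the chart and on covectors by
precomposition with the derivative of its inverse. Bundle smoothness thus becomes smoothness of the
two representatives, at every point of the chart and not only at its centre. -/
theorem contMDiffAt_section_iff_contDiffAt_rep (σ : PSection E P) {x₀ : P} {y : E}
    (hy : y ∈ (extChartAt 𝓘(ℝ, E) x₀).target) :
    ContMDiffAt 𝓘(ℝ, E) (𝓘(ℝ, E).prod 𝓘(ℝ, E × (E →L[ℝ] ℝ))) ∞
      (fun x => TotalSpace.mk' (E × (E →L[ℝ] ℝ)) (E := fun x : P => Pontryagin E x) x (σ x))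
      ((extChartAt 𝓘(ℝ, E) x₀).symm y) ↔
    ContDiffAt ℝ ∞ (vecRep (fun x => (σ x).1) x₀) y ∧
      ContDiffAt ℝ ∞ (covRep (fun x => (σ x).2) x₀) y := by
  have hx := symm_mem_chartAt_source hy
  rw [(trivializationAt (E × (E →L[ℝ] ℝ)) (fun x : P => Pontryagin E x) x₀).contMDiffAt_section_iff
    (by exact ⟨hx, hx, mem_univ _⟩), contMDiffAt_iff_contDiffAt_comp_symm hy]
  refine Iff.trans (contDiffAt_congr_iff ?_) (contDiffAt_prod_iff (fun z =>
    (vecRep (fun x => (σ x).1) x₀ z, covRep (fun x => (σ x).2) x₀ z)))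
  filter_upwards [(isOpen_target x₀).mem_nhds hy] with z hz
  exact trivializationAt_pontryagin_apply hz _

set_option synthInstance.maxHeartbeats 200000 in
theorem contMDiffAt_bilField_iff_contDiffAt_bilRep (B : BilField E P) {x₀ : P} {y : E}
    (hy : y ∈ (extChartAt 𝓘(ℝ, E) x₀).target) :
    ContMDiffAt 𝓘(ℝ, E) (𝓘(ℝ, E).prod 𝓘(ℝ, E →L[ℝ] E →L[ℝ] ℝ)) ∞
      (fun x => TotalSpace.mk' (E →L[ℝ] E →L[ℝ] ℝ) (E := fun x : P =>
        TangentSpace 𝓘(ℝ, E) x →L[ℝ] TangentSpace 𝓘(ℝ, E) x →L[ℝ] ℝ) x (B x))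
      ((extChartAt 𝓘(ℝ, E) x₀).symm y) ↔
    ContDiffAt ℝ ∞ (bilRep B x₀) y := by
  have hx := symm_mem_chartAt_source hy
  rw [(trivializationAt (E →L[ℝ] E →L[ℝ] ℝ) (fun x : P =>
        TangentSpace 𝓘(ℝ, E) x →L[ℝ] TangentSpace 𝓘(ℝ, E) x →L[ℝ] ℝ) x₀).contMDiffAt_section_iff
    (by exact ⟨hx, hx, mem_univ _⟩), contMDiffAt_iff_contDiffAt_comp_symm hy]
  refine contDiffAt_congr_iff ?_
  filter_upwards [(isOpen_target x₀).mem_nhds hy] with z hz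
  change (Trivialization.continuousLinearMap (RingHom.id ℝ)
    (trivializationAt E (TangentSpace 𝓘(ℝ, E)) x₀)
    (trivializationAt (E →L[ℝ] ℝ) (fun x : P => CotangentSpace E x) x₀)
      ⟨(extChartAt 𝓘(ℝ, E) x₀).symm z, B _⟩).2 = _
  rw [Trivialization.continuousLinearMap_apply]
  ext v w
  simp only [ContinuousLinearMap.comp_apply]
  rw [Trivialization.continuousLinearMapAt_apply, Trivialization.coe_linearMapAt_of_mem]
  · dsimp only
    rw [trivializationAt_cotangent_apply hz, symmL_symm hz]
    rfl
  · exact ⟨symm_mem_chartAt_source hz, mem_univ _⟩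

end Charts

/-! ### Chart independence of the exterior derivative -/

section ChartCalculus

variable {E : Type uE} [NormedAddCommGroup E] [NormedSpace ℝ E]
  {P : Type uP} [TopologicalSpace P] [ChartedSpace E P]

theorem SmoothForm.contDiffAt {k : ℕ} {η : DForm E P k} (hη : SmoothForm η) {x₀ : P} {y : E}
    (hy : y ∈ (extChartAt 𝓘(ℝ, E) x₀).target) : ContDiffAt ℝ ∞ (chartRep η x₀) y :=
  (hη x₀).contDiffAt ((isOpen_target x₀).mem_nhds hy)

variable [IsManifold 𝓘(ℝ, E) ∞ P]

theorem mdifferentiableAt_extChartAt_symm {x₀ : P} {y : E}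
    (hy : y ∈ (extChartAt 𝓘(ℝ, E) x₀).target) :
    MDifferentiableAt 𝓘(ℝ, E) 𝓘(ℝ, E) (extChartAt 𝓘(ℝ, E) x₀).symm y :=
  ((contMDiffOn_extChartAt_symm (n := ∞) x₀).contMDiffAt
    ((isOpen_target x₀).mem_nhds hy)).mdifferentiableAt (by simp)

theorem mdifferentiableAt_extChartAt_of_mem {x₀ p : P} (hp : p ∈ (extChartAt 𝓘(ℝ, E) x₀).source) :
    MDifferentiableAt 𝓘(ℝ, E) 𝓘(ℝ, E) (extChartAt 𝓘(ℝ, E) x₀) p :=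
  (contMDiffAt_extChartAt' (n := ∞) (by rwa [← extChartAt_source 𝓘(ℝ, E)])).mdifferentiableAt
    (by simp)

theorem chartRep_apply_mfderiv {k : ℕ} (η : DForm E P k) {x₀ p : P}
    (hp : p ∈ (extChartAt 𝓘(ℝ, E) x₀).source) (v : Fin k → TangentSpace 𝓘(ℝ, E) p) :
    chartRep η x₀ (extChartAt 𝓘(ℝ, E) x₀ p)
      (fun i => mfderiv 𝓘(ℝ, E) 𝓘(ℝ, E) (extChartAt 𝓘(ℝ, E) x₀) p (v i)) = η p v := by
  obtain ⟨y, hy, rfl⟩ : ∃ y ∈ (extChartAt 𝓘(ℝ, E) x₀).target,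
      (extChartAt 𝓘(ℝ, E) x₀).symm y = p :=
    ⟨_, (extChartAt 𝓘(ℝ, E) x₀).map_source hp, (extChartAt 𝓘(ℝ, E) x₀).left_inv hp⟩
  have h : chartRep η x₀ (extChartAt 𝓘(ℝ, E) x₀ ((extChartAt 𝓘(ℝ, E) x₀).symm y)) =
      chartRep η x₀ y := by rw [(extChartAt 𝓘(ℝ, E) x₀).right_inv hy]
  refine (DFunLike.congr_fun h _).trans ?_
  exact congrArg (η ((extChartAt 𝓘(ℝ, E) x₀).symm y))
    (funext fun i => mfderiv_symm_extChartAt_apply hy (v i))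

theorem chartRep_transition {k : ℕ} (η : DForm E P k) {x₀ x₁ : P} {z : E}
    (hz : z ∈ (extChartAt 𝓘(ℝ, E) x₁).target)
    (hz' : (extChartAt 𝓘(ℝ, E) x₁).symm z ∈ (extChartAt 𝓘(ℝ, E) x₀).source) :
    chartRep η x₁ z =
      (chartRep η x₀ (extChartAt 𝓘(ℝ, E) x₀ ((extChartAt 𝓘(ℝ, E) x₁).symm z))).compContinuousLinearMap
        (fderiv ℝ (fun z => extChartAt 𝓘(ℝ, E) x₀ ((extChartAt 𝓘(ℝ, E) x₁).symm z)) z) := by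
  have hc : fderiv ℝ (fun z => extChartAt 𝓘(ℝ, E) x₀ ((extChartAt 𝓘(ℝ, E) x₁).symm z)) z =
      (mfderiv 𝓘(ℝ, E) 𝓘(ℝ, E) (extChartAt 𝓘(ℝ, E) x₀) ((extChartAt 𝓘(ℝ, E) x₁).symm z)).comp
        (mfderiv 𝓘(ℝ, E) 𝓘(ℝ, E) (extChartAt 𝓘(ℝ, E) x₁).symm z) := by
    rw [← mfderiv_eq_fderiv]
    exact mfderiv_comp z (mdifferentiableAt_extChartAt_of_mem hz')
      (mdifferentiableAt_extChartAt_symm hz)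
  ext v
  rw [hc]
  exact (chartRep_apply_mfderiv η hz' _).symm

/-- `extD` uses a different chart at each point. Since the exterior derivative commutes with
pullback by the transition map τ, one fixed chart computes it throughout its domain; without this,
neither smoothness of dη nor d² = 0 could be read off. -/
theorem extD_apply_eq_extDeriv_chartRep {k : ℕ} {η : DForm E P k} (hη : SmoothForm η) {x₀ p : P}
    (hp : p ∈ (extChartAt 𝓘(ℝ, E) x₀).source) (v : Fin (k + 1) → TangentSpace 𝓘(ℝ, E) p) :
    extD η p v = extDeriv (chartRep η x₀) (extChartAt 𝓘(ℝ, E) x₀ p)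
      (fun i => mfderiv 𝓘(ℝ, E) 𝓘(ℝ, E) (extChartAt 𝓘(ℝ, E) x₀) p (v i)) := by
  set τ : E → E := fun z => extChartAt 𝓘(ℝ, E) x₀ ((extChartAt 𝓘(ℝ, E) p).symm z) with hτ
  set z₁ := extChartAt 𝓘(ℝ, E) p p with hz₁
  have hpt : z₁ ∈ (extChartAt 𝓘(ℝ, E) p).target := mem_extChartAt_target p
  have hsymm : (extChartAt 𝓘(ℝ, E) p).symm z₁ = p := extChartAt_to_inv p
  have hnhds : ∀ᶠ z in 𝓝 z₁, z ∈ (extChartAt 𝓘(ℝ, E) p).target ∧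
      (extChartAt 𝓘(ℝ, E) p).symm z ∈ (extChartAt 𝓘(ℝ, E) x₀).source := by
    refine Filter.Eventually.and ((isOpen_target p).eventually_mem hpt) ?_
    refine (continuousAt_extChartAt_symm p).eventually ?_
    rw [extChartAt_to_inv]
    exact (isOpen_extChartAt_source x₀).mem_nhds hp
  have heq : chartRep η p =ᶠ[𝓝 z₁]
      fun z => (chartRep η x₀ (τ z)).compContinuousLinearMap (fderiv ℝ τ z) := by
    filter_upwards [hnhds] with z hz
    exact chartRep_transition η hz.1 hz.2
  have hτd : ContDiffAt ℝ ∞ τ z₁ := by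
    rw [← contMDiffAt_iff_contDiffAt]
    refine ContMDiffAt.comp (I' := 𝓘(ℝ, E)) z₁ (g := extChartAt 𝓘(ℝ, E) x₀) ?_
      ((contMDiffOn_extChartAt_symm (n := ∞) p).contMDiffAt ((isOpen_target p).mem_nhds hpt))
    refine contMDiffAt_extChartAt' ?_
    rwa [hsymm, ← extChartAt_source 𝓘(ℝ, E)]
  have hτz : τ z₁ = extChartAt 𝓘(ℝ, E) x₀ p := by rw [hτ]; simp only [hsymm]
  have hηd : DifferentiableAt ℝ (chartRep η x₀) (τ z₁) := by
    rw [hτz]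
    exact ((hη x₀).contDiffAt ((isOpen_target x₀).mem_nhds
      ((extChartAt 𝓘(ℝ, E) x₀).map_source hp))).differentiableAt (by simp)
  have hpull := extDeriv_pullback hηd hτd (by simpa using ENat.LEInfty.out)
  have hfd : ∀ w : TangentSpace 𝓘(ℝ, E) p,
      fderiv ℝ τ z₁ (mfderiv 𝓘(ℝ, E) 𝓘(ℝ, E) (extChartAt 𝓘(ℝ, E) p) p w) =
        mfderiv 𝓘(ℝ, E) 𝓘(ℝ, E) (extChartAt 𝓘(ℝ, E) x₀) p w := by
    intro w
    have hev : (fun q => τ (extChartAt 𝓘(ℝ, E) p q)) =ᶠ[𝓝 p] extChartAt 𝓘(ℝ, E) x₀ := by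
      filter_upwards [extChartAt_source_mem_nhds (I := 𝓘(ℝ, E)) p] with q hq
      simp only [hτ, (extChartAt 𝓘(ℝ, E) p).left_inv hq]
    have h1 := hev.mfderiv_eq (I := 𝓘(ℝ, E)) (I' := 𝓘(ℝ, E))
    have h2 : mfderiv 𝓘(ℝ, E) 𝓘(ℝ, E) (fun q => τ (extChartAt 𝓘(ℝ, E) p q)) p =
        (mfderiv 𝓘(ℝ, E) 𝓘(ℝ, E) τ z₁).comp
          (mfderiv 𝓘(ℝ, E) 𝓘(ℝ, E) (extChartAt 𝓘(ℝ, E) p) p) :=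
      mfderiv_comp p (hτd.differentiableAt (by simp)).mdifferentiableAt
        (mdifferentiableAt_extChartAt_of_mem (mem_extChartAt_source p))
    rw [mfderiv_eq_fderiv] at h2
    exact (DFunLike.congr_fun h2 w).symm.trans (DFunLike.congr_fun h1 w)
  change extDeriv (chartRep η p) z₁
    (fun i => mfderiv 𝓘(ℝ, E) 𝓘(ℝ, E) (extChartAt 𝓘(ℝ, E) p) p (v i)) = _
  rw [heq.extDeriv_eq, hpull, ← hτz]
  exact congrArg (extDeriv (chartRep η x₀) (τ z₁)) (funext fun i => hfd (v i))

theorem chartRep_extD {k : ℕ} {η : DForm E P k} (hη : SmoothForm η) {x₀ : P} {y : E}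
    (hy : y ∈ (extChartAt 𝓘(ℝ, E) x₀).target) :
    chartRep (extD η) x₀ y = extDeriv (chartRep η x₀) y := by
  ext v
  have h := extD_apply_eq_extDeriv_chartRep hη ((extChartAt 𝓘(ℝ, E) x₀).map_target hy)
    (fun i => mfderiv 𝓘(ℝ, E) 𝓘(ℝ, E) (extChartAt 𝓘(ℝ, E) x₀).symm y (v i))
  refine h.trans ?_
  rw [(extChartAt 𝓘(ℝ, E) x₀).right_inv hy]
  exact congrArg (extDeriv (chartRep η x₀) y)
    (funext fun i => mfderiv_extChartAt_symm_apply hy (v i))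

theorem contDiffAt_extDeriv {k : ℕ} {f : E → E [⋀^Fin k]→L[ℝ] ℝ} {y : E}
    (hf : ContDiffAt ℝ ∞ f y) : ContDiffAt ℝ ∞ (extDeriv f) y :=
  ContDiffAt.comp (g := ContinuousAlternatingMap.alternatizeUncurryFinCLM ℝ E ℝ) y
    (ContinuousLinearMap.contDiff _).contDiffAt (hf.fderiv_right (m := ∞) (by simp))

theorem smoothForm_extD {k : ℕ} {η : DForm E P k} (hη : SmoothForm η) : SmoothForm (extD η) := by
  intro x₀ y hy
  refine ContDiffAt.contDiffWithinAt ?_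
  rw [contDiffAt_congr_iff (g := extDeriv (chartRep η x₀))]
  · exact contDiffAt_extDeriv (hη.contDiffAt hy)
  · filter_upwards [(isOpen_target x₀).mem_nhds hy] with z hz
    exact chartRep_extD hη hz

theorem extD_extD {k : ℕ} {η : DForm E P k} (hη : SmoothForm η) :
    extD (extD η) = 0 := by
  funext p
  have hp := mem_extChartAt_target (I := 𝓘(ℝ, E)) p
  have heq : chartRep (extD η) p =ᶠ[𝓝 (extChartAt 𝓘(ℝ, E) p p)]
      extDeriv (chartRep η p) := by
    filter_upwards [(isOpen_target p).mem_nhds hp] with z hz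
    exact chartRep_extD hη hz
  ext v
  change extDeriv (chartRep (extD η) p) _
    (fun i => mfderiv 𝓘(ℝ, E) 𝓘(ℝ, E) (extChartAt 𝓘(ℝ, E) p) p (v i)) = 0
  rw [heq.extDeriv_eq, extDeriv_extDeriv_apply (hη.contDiffAt hp)
    (by simpa using ENat.LEInfty.out)]
  rfl

end ChartCalculus

/-! ### The Courant bracket in charts -/

section CourantInCharts

open VectorField

variable {E : Type uE} [NormedAddCommGroup E] [NormedSpace ℝ E]
  {P : Type uP} [TopologicalSpace P] [ChartedSpace E P]

/-- Insertion of a vector in a two-form, as a bilinear operation in a vector space. -/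
def insertTwo (u : E) (η : E [⋀^Fin 2]→L[ℝ] ℝ) : E →L[ℝ] ℝ :=
  (ContinuousAlternatingMap.ofSubsingletonLIE (𝕜 := ℝ) (E := E) (F := ℝ) (0 : Fin 1)).symm
    (ContinuousAlternatingMap.curryLeft η u)

theorem insertTwo_apply (u w : E) (η : E [⋀^Fin 2]→L[ℝ] ℝ) : insertTwo u η w = η ![u, w] := by
  change η (Matrix.vecCons u (fun _ => w)) = _
  congr 1; ext i; fin_cases i <;> rfl

theorem contDiffAt_insertTwo {u : E → E} {η : E → E [⋀^Fin 2]→L[ℝ] ℝ} {y : E}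
    (hu : ContDiffAt ℝ ∞ u y) (hη : ContDiffAt ℝ ∞ η y) :
    ContDiffAt ℝ ∞ (fun z => insertTwo (u z) (η z)) y := by
  have h1 : ContDiffAt ℝ ∞ (fun z => ContinuousAlternatingMap.curryLeft (η z)) y :=
    ContDiffAt.comp y (g := (ContinuousAlternatingMap.curryLeftLI :
      E [⋀^Fin 2]→L[ℝ] ℝ →ₗᵢ[ℝ] E →L[ℝ] E [⋀^Fin 1]→L[ℝ] ℝ))
      (LinearIsometry.contDiff _).contDiffAt hη
  exact ContDiffAt.comp y (LinearIsometryEquiv.contDiff _).contDiffAt (h1.clm_apply hu)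

theorem contDiffAt_curryLeft {u : E → E} {η : E → E [⋀^Fin 3]→L[ℝ] ℝ} {y : E}
    (hu : ContDiffAt ℝ ∞ u y) (hη : ContDiffAt ℝ ∞ η y) :
    ContDiffAt ℝ ∞ (fun z => ContinuousAlternatingMap.curryLeft (η z) (u z)) y := by
  have h1 : ContDiffAt ℝ ∞ (fun z => ContinuousAlternatingMap.curryLeft (η z)) y :=
    ContDiffAt.comp y (g := (ContinuousAlternatingMap.curryLeftLI :
      E [⋀^Fin 3]→L[ℝ] ℝ →ₗᵢ[ℝ] E →L[ℝ] E [⋀^Fin 2]→L[ℝ] ℝ))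
      (LinearIsometry.contDiff _).contDiffAt hη
  exact h1.clm_apply hu

theorem chartRep_toForm (α : CovField E P) (x₀ : P) :
    chartRep (toForm α) x₀ = fun y =>
      ContinuousAlternatingMap.ofSubsingleton ℝ E ℝ (0 : Fin 1) (covRep α x₀ y) := rfl

theorem smoothForm_toForm {α : CovField E P}
    (hα : ∀ x₀ : P, ContDiffOn ℝ ∞ (covRep α x₀) (extChartAt 𝓘(ℝ, E) x₀).target) :
    SmoothForm (toForm α) := fun x₀ =>
  (LinearIsometryEquiv.contDiff (ContinuousAlternatingMap.ofSubsingletonLIE (𝕜 := ℝ) (E := E)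
    (F := ℝ) (0 : Fin 1))).comp_contDiffOn (hα x₀)

variable [IsManifold 𝓘(ℝ, E) ∞ P]

theorem covRep_vecRep (α : CovField E P) (X : VField E P) {x₀ : P} {y : E}
    (hy : y ∈ (extChartAt 𝓘(ℝ, E) x₀).target) :
    covRep α x₀ y (vecRep X x₀ y) =
      α ((extChartAt 𝓘(ℝ, E) x₀).symm y) (X ((extChartAt 𝓘(ℝ, E) x₀).symm y)) :=
  congrArg (α ((extChartAt 𝓘(ℝ, E) x₀).symm y)) (mfderiv_symm_extChartAt_apply hy _)

theorem covRep_contract₁ (X : VField E P) (η : DForm E P 2) {x₀ : P} {y : E}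
    (hy : y ∈ (extChartAt 𝓘(ℝ, E) x₀).target) :
    covRep (fun x => contract₁ (X x) (η x)) x₀ y =
      insertTwo (vecRep X x₀ y) (chartRep η x₀ y) := by
  ext w
  rw [insertTwo_apply]
  refine (contract₁_apply _ _ _).trans ?_
  refine congrArg (η ((extChartAt 𝓘(ℝ, E) x₀).symm y)) ?_
  ext i
  fin_cases i
  · exact (mfderiv_symm_extChartAt_apply hy _).symm
  · rfl

theorem covRep_contract₂ (X Y : VField E P) (η : DForm E P 3) {x₀ : P} {y : E}
    (hy : y ∈ (extChartAt 𝓘(ℝ, E) x₀).target) :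
    covRep (fun x => contract₂ (X x) (Y x) (η x)) x₀ y =
      insertTwo (vecRep Y x₀ y)
        (ContinuousAlternatingMap.curryLeft (chartRep η x₀ y) (vecRep X x₀ y)) := by
  ext w
  rw [insertTwo_apply]
  refine (contract₂_apply _ _ _ _).trans ?_
  refine congrArg (η ((extChartAt 𝓘(ℝ, E) x₀).symm y)) ?_
  ext i
  fin_cases i
  · exact (mfderiv_symm_extChartAt_apply hy _).symm
  · exact (mfderiv_symm_extChartAt_apply hy _).symm
  · rfl

theorem covRep_mvfderiv {f : P → ℝ} {x₀ : P} {y : E}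
    (hy : y ∈ (extChartAt 𝓘(ℝ, E) x₀).target)
    (hf : ContDiffAt ℝ ∞ (fun z => f ((extChartAt 𝓘(ℝ, E) x₀).symm z)) y) :
    covRep (fun x => mvfderiv 𝓘(ℝ, E) f x) x₀ y =
      fderiv ℝ (fun z => f ((extChartAt 𝓘(ℝ, E) x₀).symm z)) y := by
  have hfm := (contMDiffAt_iff_contDiffAt_comp_symm hy).2 hf
  have h := mfderiv_comp y (hfm.mdifferentiableAt (by simp))
    (mdifferentiableAt_extChartAt_symm hy)
  rw [← mfderiv_eq_fderiv]
  exact h.symm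

theorem contMDiffAt_vField_iff_contDiffAt_vecRep (X : VField E P) {x₀ : P} {y : E}
    (hy : y ∈ (extChartAt 𝓘(ℝ, E) x₀).target) :
    ContMDiffAt 𝓘(ℝ, E) (𝓘(ℝ, E).prod 𝓘(ℝ, E)) ∞
      (fun x => TotalSpace.mk' E (E := fun x : P => TangentSpace 𝓘(ℝ, E) x) x (X x))
      ((extChartAt 𝓘(ℝ, E) x₀).symm y) ↔
    ContDiffAt ℝ ∞ (vecRep X x₀) y := by
  have hx := symm_mem_chartAt_source hy
  rw [(trivializationAt E (fun x : P => TangentSpace 𝓘(ℝ, E) x) x₀).contMDiffAt_section_iff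
    (by exact hx), contMDiffAt_iff_contDiffAt_comp_symm hy]
  refine contDiffAt_congr_iff ?_
  filter_upwards [(isOpen_target x₀).mem_nhds hy] with z hz
  refine Eq.trans ?_ (congrArg (fun l : TangentSpace 𝓘(ℝ, E) _ →L[ℝ] E => l (X _))
    (continuousLinearMapAt_symm hz))
  exact (congrFun (Trivialization.coe_linearMapAt_of_mem (R := ℝ)
    (trivializationAt E (TangentSpace 𝓘(ℝ, E)) x₀) (symm_mem_chartAt_source hz)) _).symm

theorem mpullback_extChartAt_symm (X : VField E P) {x₀ : P} {y : E}
    (hy : y ∈ (extChartAt 𝓘(ℝ, E) x₀).target) :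
    mpullback 𝓘(ℝ, E) 𝓘(ℝ, E) (extChartAt 𝓘(ℝ, E) x₀).symm X y = vecRep X x₀ y := by
  rw [mpullback_apply]
  have h : (mfderiv 𝓘(ℝ, E) 𝓘(ℝ, E) (extChartAt 𝓘(ℝ, E) x₀).symm y).inverse =
      mfderiv 𝓘(ℝ, E) 𝓘(ℝ, E) (extChartAt 𝓘(ℝ, E) x₀) ((extChartAt 𝓘(ℝ, E) x₀).symm y) := by
    refine ContinuousLinearMap.inverse_eq ?_ ?_
    · ext v
      exact mfderiv_symm_extChartAt_apply hy v
    · ext v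
      exact mfderiv_extChartAt_symm_apply hy v
  rw [h]
  rfl

theorem mlieBracket_eq_lieBracket (V W : ∀ x : E, TangentSpace 𝓘(ℝ, E) x) (y : E) :
    mlieBracket 𝓘(ℝ, E) V W y = lieBracket ℝ V W y := by
  rw [← mlieBracketWithin_univ, mlieBracketWithin_eq_lieBracketWithin]
  exact congrFun lieBracketWithin_univ y

/-- The representative of a field is its pullback by the inverse chart, and the Lie bracket is
natural under pullback. -/
theorem vecRep_mlieBracket [CompleteSpace E] {X Y : VField E P} {x₀ : P} {y : E}
    (hy : y ∈ (extChartAt 𝓘(ℝ, E) x₀).target)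
    (hX : ContDiffAt ℝ ∞ (vecRep X x₀) y) (hY : ContDiffAt ℝ ∞ (vecRep Y x₀) y) :
    vecRep (mlieBracket 𝓘(ℝ, E) X Y) x₀ y =
      lieBracket ℝ (vecRep X x₀) (vecRep Y x₀) y := by
  have : IsManifold 𝓘(ℝ, E) (minSmoothness ℝ 2) P :=
    IsManifold.of_le (n := ∞) (by simpa using ENat.LEInfty.out)
  have hX' := ((contMDiffAt_vField_iff_contDiffAt_vecRep X hy).2 hX).mdifferentiableAt (by simp)
  have hY' := ((contMDiffAt_vField_iff_contDiffAt_vecRep Y hy).2 hY).mdifferentiableAt (by simp)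
  have hev : ∀ Z : VField E P, mpullback 𝓘(ℝ, E) 𝓘(ℝ, E) (extChartAt 𝓘(ℝ, E) x₀).symm Z =ᶠ[𝓝 y]
      vecRep Z x₀ := by
    intro Z
    filter_upwards [(isOpen_target x₀).mem_nhds hy] with z hz
    exact mpullback_extChartAt_symm Z hz
  rw [← mpullback_extChartAt_symm _ hy, mpullback_mlieBracket (n := ∞) hX' hY'
    ((contMDiffOn_extChartAt_symm (n := ∞) x₀).contMDiffAt ((isOpen_target x₀).mem_nhds hy))
    (by simpa using ENat.LEInfty.out),
    Filter.EventuallyEq.mlieBracket_vectorField_eq (hev X) (hev Y)]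
  exact mlieBracket_eq_lieBracket _ _ _

theorem contDiffAt_lieBracket {X Y : E → E} {y : E} (hX : ContDiffAt ℝ ∞ X y)
    (hY : ContDiffAt ℝ ∞ Y y) : ContDiffAt ℝ ∞ (lieBracket ℝ X Y) y := by
  rw [lieBracket_eq]
  exact ((hY.fderiv_right (m := ∞) (by simp)).clm_apply hX).sub
    ((hX.fderiv_right (m := ∞) (by simp)).clm_apply hY)

theorem SmoothSectionOn.contDiffAt_rep {σ : PSection E P} {U : Set P} (hσ : SmoothSectionOn σ U)
    (hU : IsOpen U) {x₀ : P} {y : E} (hy : y ∈ (extChartAt 𝓘(ℝ, E) x₀).target)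
    (hyU : (extChartAt 𝓘(ℝ, E) x₀).symm y ∈ U) :
    ContDiffAt ℝ ∞ (vecRep (fun x => (σ x).1) x₀) y ∧
      ContDiffAt ℝ ∞ (covRep (fun x => (σ x).2) x₀) y :=
  (contMDiffAt_section_iff_contDiffAt_rep σ hy).1 (hσ.contMDiffAt (hU.mem_nhds hyU))

theorem SmoothSectionOn.smoothForm_toForm_snd {σ : PSection E P} (hσ : SmoothSectionOn σ univ) :
    SmoothForm (toForm fun x => (σ x).2) :=
  smoothForm_toForm fun _ _ hy =>
    (hσ.contDiffAt_rep isOpen_univ hy (mem_univ _)).2.contDiffWithinAt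

/-- Each term of the bracket is natural under the chart. The formula serves both for the smoothness
of the bracket and for its pairing with elements of L. -/
theorem covRep_courant {φ : DForm E P 3} {σ τ : PSection E P}
    (hσ : SmoothSectionOn σ univ) (hτ : SmoothSectionOn τ univ) {x₀ : P} {y : E}
    (hy : y ∈ (extChartAt 𝓘(ℝ, E) x₀).target) :
    covRep (fun x => (courant φ σ τ x).2) x₀ y =
      fderiv ℝ (fun z => covRep (fun x => (τ x).2) x₀ z (vecRep (fun x => (σ x).1) x₀ z)) y
      + insertTwo (vecRep (fun x => (σ x).1) x₀ y)
          (extDeriv (chartRep (toForm fun x => (τ x).2) x₀) y)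
      - insertTwo (vecRep (fun x => (τ x).1) x₀ y)
          (extDeriv (chartRep (toForm fun x => (σ x).2) x₀) y)
      + insertTwo (vecRep (fun x => (τ x).1) x₀ y)
          (ContinuousAlternatingMap.curryLeft (chartRep φ x₀ y)
            (vecRep (fun x => (σ x).1) x₀ y)) := by
  obtain ⟨hX, ha⟩ := hσ.contDiffAt_rep isOpen_univ hy (mem_univ _)
  obtain ⟨hY, hb⟩ := hτ.contDiffAt_rep isOpen_univ hy (mem_univ _)
  have hev : (fun z => covRep (fun x => (τ x).2) x₀ z (vecRep (fun x => (σ x).1) x₀ z)) =ᶠ[𝓝 y]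
      fun z => (fun x => (τ x).2 (σ x).1) ((extChartAt 𝓘(ℝ, E) x₀).symm z) := by
    filter_upwards [(isOpen_target x₀).mem_nhds hy] with z hz
    exact covRep_vecRep (fun x => (τ x).2) (fun x => (σ x).1) hz
  rw [hev.fderiv_eq, ← covRep_mvfderiv (f := fun x => (τ x).2 (σ x).1) hy
      ((contDiffAt_congr_iff hev).1 (hb.clm_apply hX)),
    ← chartRep_extD hτ.smoothForm_toForm_snd hy, ← chartRep_extD hσ.smoothForm_toForm_snd hy,
    ← covRep_contract₁ (fun x => (σ x).1) _ hy, ← covRep_contract₁ (fun x => (τ x).1) _ hy,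
    ← covRep_contract₂ (fun x => (σ x).1) (fun x => (τ x).1) φ hy]
  rfl

theorem smoothSectionOn_courant [CompleteSpace E] {φ : DForm E P 3} (hφ : SmoothForm φ)
    {σ τ : PSection E P} (hσ : SmoothSectionOn σ univ) (hτ : SmoothSectionOn τ univ) :
    SmoothSectionOn (courant φ σ τ) univ := by
  intro p _
  have hp := mem_extChartAt_target (I := 𝓘(ℝ, E)) p
  rw [contMDiffWithinAt_univ]
  have key := (contMDiffAt_section_iff_contDiffAt_rep (courant φ σ τ) hp).2
  rw [extChartAt_to_inv] at key
  refine key ?_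
  obtain ⟨hX, ha⟩ := hσ.contDiffAt_rep isOpen_univ hp (mem_univ _)
  obtain ⟨hY, hb⟩ := hτ.contDiffAt_rep isOpen_univ hp (mem_univ _)
  have hT := (isOpen_target (E := E) p).mem_nhds hp
  constructor
  · refine (contDiffAt_lieBracket hX hY).congr_of_eventuallyEq ?_
    filter_upwards [hT] with z hz
    exact vecRep_mlieBracket hz (hσ.contDiffAt_rep isOpen_univ hz (mem_univ _)).1
      (hτ.contDiffAt_rep isOpen_univ hz (mem_univ _)).1
  · refine ContDiffAt.congr_of_eventuallyEq ?_ (Filter.eventually_of_mem hT fun z hz =>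
      covRep_courant hσ hτ hz)
    refine (((hb.clm_apply hX).fderiv_right (m := ∞) (by simp)).add ?_).sub ?_ |>.add ?_
    · exact contDiffAt_insertTwo hX
        (contDiffAt_extDeriv (hτ.smoothForm_toForm_snd.contDiffAt hp))
    · exact contDiffAt_insertTwo hY
        (contDiffAt_extDeriv (hσ.smoothForm_toForm_snd.contDiffAt hp))
    · exact contDiffAt_insertTwo hY (contDiffAt_curryLeft hX (hφ.contDiffAt hp))

end CourantInCharts

/-! ### Integrable distributions are involutive -/

section Involutivity

open VectorField

variable {E : Type uE} [NormedAddCommGroup E] [NormedSpace ℝ E]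
  {P : Type uP} [TopologicalSpace P] [ChartedSpace E P]

theorem vecRep_extChartAt (X : VField E P) {x₀ p : P}
    (hp : p ∈ (extChartAt 𝓘(ℝ, E) x₀).source) :
    vecRep X x₀ (extChartAt 𝓘(ℝ, E) x₀ p) =
      mfderiv 𝓘(ℝ, E) 𝓘(ℝ, E) (extChartAt 𝓘(ℝ, E) x₀) p (X p) := by
  obtain ⟨y, hy, rfl⟩ : ∃ y ∈ (extChartAt 𝓘(ℝ, E) x₀).target,
      (extChartAt 𝓘(ℝ, E) x₀).symm y = p :=
    ⟨_, (extChartAt 𝓘(ℝ, E) x₀).map_source hp, (extChartAt 𝓘(ℝ, E) x₀).left_inv hp⟩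
  rw [(extChartAt 𝓘(ℝ, E) x₀).right_inv hy]
  rfl

variable [IsManifold 𝓘(ℝ, E) ∞ P]

theorem mfderiv_extChartAt_injective {x₀ p : P} (hp : p ∈ (extChartAt 𝓘(ℝ, E) x₀).source) :
    Injective (mfderiv 𝓘(ℝ, E) 𝓘(ℝ, E) (extChartAt 𝓘(ℝ, E) x₀) p) := by
  obtain ⟨y, hy, rfl⟩ : ∃ y ∈ (extChartAt 𝓘(ℝ, E) x₀).target,
      (extChartAt 𝓘(ℝ, E) x₀).symm y = p :=
    ⟨_, (extChartAt 𝓘(ℝ, E) x₀).map_source hp, (extChartAt 𝓘(ℝ, E) x₀).left_inv hp⟩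
  intro u v huv
  rw [← mfderiv_symm_extChartAt_apply hy u, ← mfderiv_symm_extChartAt_apply hy v]
  exact congrArg _ huv

/-- Read in charts, the inclusion of the leaf through x is an immersion J whose tangent images are
F, so `lieBracket_mem_range_fderiv` applies. This is the easy direction of Frobenius; only
continuity of the inclusion is used to localize, so the leaf need not be embedded. -/
theorem mlieBracket_mem_of_isIntegrable [FiniteDimensional ℝ E] {F : Distrib E P}
    (hF : IsIntegrable F) {X Y : VField E P} {x : P}
    (hX : ContDiffAt ℝ ∞ (vecRep X x) (extChartAt 𝓘(ℝ, E) x x))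
    (hY : ContDiffAt ℝ ∞ (vecRep Y x) (extChartAt 𝓘(ℝ, E) x x))
    (hXF : ∀ᶠ p in 𝓝 x, X p ∈ F p) (hYF : ∀ᶠ p in 𝓝 x, Y p ∈ F p) :
    mlieBracket 𝓘(ℝ, E) X Y x ∈ F x := by
  have : CompleteSpace E := FiniteDimensional.complete ℝ E
  obtain ⟨leaves, hpart, hleaves⟩ := hF
  obtain ⟨O, ⟨hO, hxO⟩, -⟩ := hpart.2 x
  obtain ⟨r, N, _, _, j, hN, -, -, rfl, hj, hjr⟩ := hleaves O hO
  obtain ⟨n₀, rfl⟩ := hxO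
  set e := extChartAt 𝓘(ℝ, E) (j n₀) with he
  set c := extChartAt (𝓡 r) n₀ with hc
  set v₀ := c n₀ with hv₀
  have hv₀t : v₀ ∈ c.target := mem_extChartAt_target n₀
  have hcv : c.symm v₀ = n₀ := extChartAt_to_inv n₀
  set J : EuclideanSpace ℝ (Fin r) → E := fun v => e (j (c.symm v)) with hJ
  have hcont : ContinuousAt (fun v => j (c.symm v)) v₀ := by
    refine ContinuousAt.comp (g := j) ?_ (continuousAt_extChartAt_symm n₀)
    exact hj.continuous.continuousAt
  have hjv : j (c.symm v₀) = j n₀ := by rw [hcv]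
  have hnhds : ∀ᶠ v in 𝓝 v₀, v ∈ c.target ∧ j (c.symm v) ∈ e.source := by
    refine ((isOpen_target n₀).eventually_mem hv₀t).and (hcont.eventually ?_)
    change ∀ᶠ p in 𝓝 (j (c.symm v₀)), p ∈ e.source
    rw [hjv]
    exact (isOpen_extChartAt_source (j n₀)).mem_nhds (mem_extChartAt_source (j n₀))
  have hJd : ContDiffAt ℝ ∞ J v₀ := by
    rw [← contMDiffAt_iff_contDiffAt]
    refine ContMDiffAt.comp (I' := 𝓘(ℝ, E)) v₀ (g := e) (f := fun v => j (c.symm v)) ?_ ?_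
    · refine contMDiffAt_extChartAt' ?_
      rw [hjv]
      exact mem_chart_source E (j n₀)
    · exact ContMDiffAt.comp (I' := 𝓡 r) v₀ (g := j) hj.contMDiffAt
        ((contMDiffOn_extChartAt_symm (n := ∞) n₀).contMDiffAt
          ((isOpen_target n₀).mem_nhds hv₀t))
  have hfd : ∀ v, v ∈ c.target ∧ j (c.symm v) ∈ e.source → ∀ u,
      fderiv ℝ J v u = mfderiv 𝓘(ℝ, E) 𝓘(ℝ, E) e (j (c.symm v))
        (mfderiv (𝓡 r) 𝓘(ℝ, E) j (c.symm v) (mfderiv (𝓡 r) (𝓡 r) c.symm v u)) := by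
    intro v hv u
    have hjd : MDifferentiableAt (𝓡 r) 𝓘(ℝ, E) j (c.symm v) := hj.mdifferentiableAt (by simp)
    have hcd : MDifferentiableAt (𝓡 r) (𝓡 r) c.symm v := mdifferentiableAt_extChartAt_symm hv.1
    have h1 := mfderiv_comp v hjd hcd
    have h2 := mfderiv_comp (g := e) (f := j ∘ c.symm) v
      (mdifferentiableAt_extChartAt_of_mem hv.2) (hjd.comp v hcd)
    rw [← mfderiv_eq_fderiv]
    rw [h1] at h2
    exact DFunLike.congr_fun h2 u
  have hsurj : ∀ v, v ∈ c.target ∧ j (c.symm v) ∈ e.source →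
      ∀ Z : VField E P, Z (j (c.symm v)) ∈ F (j (c.symm v)) →
        vecRep Z (j n₀) (J v) ∈ (fderiv ℝ J v).range := by
    intro v hv Z hZ
    rw [← (hjr (c.symm v)).2] at hZ
    obtain ⟨u, hu⟩ := hZ
    refine ⟨mfderiv (𝓡 r) (𝓡 r) c (c.symm v) u, ?_⟩
    refine (hfd v hv _).trans ?_
    rw [hJ, vecRep_extChartAt Z hv.2]
    refine congrArg (mfderiv 𝓘(ℝ, E) 𝓘(ℝ, E) e (j (c.symm v))) (Eq.trans ?_ hu)
    exact congrArg (mfderiv (𝓡 r) 𝓘(ℝ, E) j (c.symm v)) (mfderiv_symm_extChartAt_apply hv.1 u)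
  have hinj : Injective (fderiv ℝ J v₀) := by
    have hv := hnhds.self_of_nhds
    intro u w huw
    rw [hfd v₀ hv, hfd v₀ hv] at huw
    have h1 := (hjr _).1 (mfderiv_extChartAt_injective hv.2 huw)
    rw [← mfderiv_extChartAt_symm_apply hv.1 u, ← mfderiv_extChartAt_symm_apply hv.1 w]
    exact congrArg _ h1
  have hJ₀ : J v₀ = e (j n₀) := by rw [hJ]; simp only [hcv]
  have hmem : ∀ Z : VField E P, (∀ᶠ p in 𝓝 (j n₀), Z p ∈ F p) →
      ∀ᶠ v in 𝓝 v₀, vecRep Z (j n₀) (J v) ∈ (fderiv ℝ J v).range := by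
    intro Z hZ
    rw [← hjv] at hZ
    filter_upwards [hnhds, hcont.eventually hZ] with v hv hZv
    exact hsurj v hv Z hZv
  have hbr := lieBracket_mem_range_fderiv hJd hinj (hJ₀ ▸ hX) (hJ₀ ▸ hY) (hmem X hXF) (hmem Y hYF)
  obtain ⟨u, hu⟩ := hbr
  have hu : fderiv ℝ J v₀ u = _ := hu
  rw [hfd v₀ hnhds.self_of_nhds, hJ₀, ← vecRep_mlieBracket (mem_extChartAt_target _) hX hY,
    vecRep_extChartAt _ (mem_extChartAt_source _)] at hu
  -- The points `c.symm v₀` and `n₀` are only propositionally equal, so the tangent vector is moved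
  -- between their fibres by generalizing over n.
  have hlast : ∀ n : N, n = n₀ → ∀ w : TangentSpace (𝓡 r) n,
      mfderiv 𝓘(ℝ, E) 𝓘(ℝ, E) e (j n) (mfderiv (𝓡 r) 𝓘(ℝ, E) j n w) =
        mfderiv 𝓘(ℝ, E) 𝓘(ℝ, E) e (j n₀) (mlieBracket 𝓘(ℝ, E) X Y (j n₀)) →
      mlieBracket 𝓘(ℝ, E) X Y (j n₀) ∈ F (j n₀) := by
    rintro n rfl w hw
    rw [← (hjr n).2]
    exact ⟨w, mfderiv_extChartAt_injective (mem_extChartAt_source _) hw⟩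
  exact hlast _ hcv _ hu

end Involutivity

/-! ### Extending the form induced on pr₁(L) -/

section TwoForm

variable {E : Type uE} [NormedAddCommGroup E] [NormedSpace ℝ E]
  {P : Type uP} [TopologicalSpace P] [ChartedSpace E P]

variable (E) in
/-- The alternating part of a bilinear form. -/
def altPart : (E →L[ℝ] E →L[ℝ] ℝ) →L[ℝ] E [⋀^Fin 2]→L[ℝ] ℝ :=
  (1 / 2 : ℝ) • (ContinuousAlternatingMap.alternatizeUncurryFinCLM ℝ E ℝ).comp
    (ContinuousLinearMap.compL ℝ E (E →L[ℝ] ℝ) (E [⋀^Fin 1]→L[ℝ] ℝ)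
      (ContinuousAlternatingMap.ofSubsingletonLIE (𝕜 := ℝ) (E := E) (F := ℝ) (0 : Fin 1) :
        (E →L[ℝ] ℝ) →L[ℝ] E [⋀^Fin 1]→L[ℝ] ℝ))

theorem altPart_apply (b : E →L[ℝ] E →L[ℝ] ℝ) (v : Fin 2 → E) :
    altPart E b v = (1 / 2 : ℝ) * (b (v 0) (v 1) - b (v 1) (v 0)) := by
  simp [altPart, ContinuousAlternatingMap.alternatizeUncurryFinCLM_apply,
    ContinuousAlternatingMap.alternatizeUncurryFin_apply, Fin.sum_univ_two, Fin.removeNth,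
    sub_eq_add_neg]

set_option synthInstance.maxHeartbeats 200000 in
theorem contDiffAt_altPart {b : E → E →L[ℝ] E →L[ℝ] ℝ} {y : E} (hb : ContDiffAt ℝ ∞ b y) :
    ContDiffAt ℝ ∞ (fun z => altPart E (b z)) y :=
  ContDiffAt.comp (g := altPart E) y (ContinuousLinearMap.contDiff _).contDiffAt hb

/-- The two-form obtained as the alternating part of a field of bilinear forms. -/
def altForm (B : BilField E P) : DForm E P 2 := fun x => altPart E (B x)

theorem altForm_apply (B : BilField E P) (x : P) (u w : TangentSpace 𝓘(ℝ, E) x) :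
    altForm B x ![u, w] = (1 / 2 : ℝ) * (B x u w - B x w u) :=
  altPart_apply _ _

theorem chartRep_altForm (B : BilField E P) (x₀ : P) (y : E) :
    chartRep (altForm B) x₀ y = altPart E (bilRep B x₀ y) := by
  ext v
  exact (altPart_apply _ _).trans (altPart_apply (bilRep B x₀ y) v).symm

/-- The difference a - ∑ cᵢ sᵢ lies in L and has zero vector part, so its pairing with b is its
covector evaluated at b.1, which must vanish. Thus α(Y) depends on α only through X. -/
theorem linearCombination_eq_of_mem {x : P} {L : Submodule ℝ (Pontryagin E x)} (hL : IsIsotropic L)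
    {κ : Type*} [Fintype κ] {s : κ → Pontryagin E x} (hs : ∀ i, s i ∈ L) {c : κ → ℝ}
    {a b : Pontryagin E x} (ha : a ∈ L) (hb : b ∈ L) (hac : a.1 = ∑ i, c i • (s i).1) :
    ∑ i, c i * (s i).2 b.1 = a.2 b.1 := by
  have hd : a - ∑ i, c i • s i ∈ L :=
    L.sub_mem ha (L.sum_mem fun i _ => L.smul_mem _ (hs i))
  have h := hL _ hd _ hb
  have h1 : (a - ∑ i, c i • s i).1 = 0 := by
    rw [Prod.fst_sub, Prod.fst_sum, hac]
    simp
  have h2 : (a - ∑ i, c i • s i).2 b.1 = a.2 b.1 - ∑ i, c i * (s i).2 b.1 := by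
    rw [Prod.snd_sub, Prod.snd_sum]
    simp
  rw [pairing, h1, h2, map_zero, add_zero] at h
  linarith

theorem smoothForm_altForm {B : BilField E P}
    (hB : ∀ x₀ : P, ∀ y ∈ (extChartAt 𝓘(ℝ, E) x₀).target, ContDiffAt ℝ ∞ (bilRep B x₀) y) :
    SmoothForm (altForm B) := by
  intro x₀ y hy
  refine ContDiffAt.contDiffWithinAt ?_
  rw [funext (chartRep_altForm B x₀)]
  exact contDiffAt_altPart (hB x₀ y hy)

/-- Bilinear forms on `T_x P` that extend the two-form on `pr₁(L)_x` induced by `L`. -/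
def extendingForms (L : PFamily E P) (x : P) :
    Set (TangentSpace 𝓘(ℝ, E) x →L[ℝ] TangentSpace 𝓘(ℝ, E) x →L[ℝ] ℝ) :=
  {B | ∀ a ∈ L x, ∀ b ∈ L x, B a.1 b.1 = a.2 b.1}

/-- The defining conditions are affine in B. Convexity is what the partition of unity needs;
antisymmetry is imposed only after gluing. -/
theorem convex_extendingForms (L : PFamily E P) (x : P) : Convex ℝ (extendingForms L x) := by
  intro B hB C hC s t _ _ hst a ha b hb
  have : (s • B + t • C) a.1 b.1 = s * B a.1 b.1 + t * C a.1 b.1 := rfl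
  rw [this, hB a ha b hb, hC a ha b hb, ← add_mul, hst, one_mul]

/-- The combination of the vectors `w i` with coefficients `c i`, as a continuous linear map of
`c`. -/
def combination {κ W : Type*} [Fintype κ] [NormedAddCommGroup W] [NormedSpace ℝ W] (w : κ → W) :
    (κ → ℝ) →L[ℝ] W :=
  ∑ i, (ContinuousLinearMap.proj (R := ℝ) (φ := fun _ : κ => ℝ) i).smulRight (w i)

theorem combination_apply {κ W : Type*} [Fintype κ] [NormedAddCommGroup W] [NormedSpace ℝ W]
    (w : κ → W) (c : κ → ℝ) : combination w c = ∑ i, c i • w i := by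
  simp [combination]

theorem combination_apply_apply {κ W : Type*} [Fintype κ] [NormedAddCommGroup W] [NormedSpace ℝ W]
    (w : κ → W →L[ℝ] ℝ) (c : κ → ℝ) (v : W) : combination w c v = ∑ i, c i * w i v := by
  simp [combination_apply]

theorem contDiffAt_combination {κ W : Type*} [Fintype κ] [NormedAddCommGroup W] [NormedSpace ℝ W]
    {w : κ → E → W} {y : E} (hw : ∀ i, ContDiffAt ℝ ∞ (w i) y) :
    ContDiffAt ℝ ∞ (fun z => combination fun i => w i z) y :=
  ContDiffAt.sum fun i _ =>
    (ContinuousLinearMap.smulRightL ℝ (κ → ℝ) W _).contDiff.contDiffAt.comp y (hw i)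

variable [IsManifold 𝓘(ℝ, E) ∞ P]

theorem covRep_extChartAt (α : CovField E P) {x₀ p : P}
    (hp : p ∈ (extChartAt 𝓘(ℝ, E) x₀).source) (w : TangentSpace 𝓘(ℝ, E) p) :
    covRep α x₀ (extChartAt 𝓘(ℝ, E) x₀ p)
      (mfderiv 𝓘(ℝ, E) 𝓘(ℝ, E) (extChartAt 𝓘(ℝ, E) x₀) p w) = α p w :=
  chartRep_apply_mfderiv (toForm α) hp fun _ => w

set_option synthInstance.maxHeartbeats 200000 in
-- Choose frame elements (Xᵢ, αᵢ) of L whose vector parts form a basis of pr₁(L) at x₀; by constant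
-- rank they still do nearby. With θ a smooth left inverse of c ↦ ∑ cᵢ Xᵢ, the form B(u, w) = ∑
-- θ(u)ᵢ αᵢ(w) is as required.
theorem exists_local_extendingForms [FiniteDimensional ℝ E] {L : PFamily E P}
    (hL : IsAlmostDirac L) (hreg : ConstantRank (pr₁ L)) (x₀ : P) :
    ∃ B : BilField E P, ∀ᶠ p in 𝓝 x₀, p ∈ (extChartAt 𝓘(ℝ, E) x₀).source ∧
      ContDiffAt ℝ ∞ (bilRep B x₀) (extChartAt 𝓘(ℝ, E) x₀ p) ∧ B p ∈ extendingForms L p := by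
  obtain ⟨r, hr⟩ := hreg
  obtain ⟨U, hU, hx₀U, k, s, hs, hframe⟩ := hL.subbundle x₀
  obtain ⟨κ, a, ha, hspan, hlin⟩ := exists_linearIndependent' ℝ (fun i => (s i x₀).1)
  have : Finite κ := Finite.of_injective a ha
  have := Fintype.ofFinite κ
  set e := extChartAt 𝓘(ℝ, E) x₀ with he
  have hsL : ∀ p ∈ U, ∀ i, s i p ∈ L p := fun p hp i => by
    rw [← (hframe p hp).2]
    exact Submodule.subset_span ⟨i, rfl⟩
  have hpr : ∀ p ∈ U, pr₁ L p = Submodule.span ℝ (range fun i => (s i p).1) := fun p hp => by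
    rw [pr₁, ← (hframe p hp).2, Submodule.map_span, ← range_comp]
    rfl
  have hcard : Fintype.card κ = r := by
    rw [← hr x₀, hpr x₀ hx₀U, ← hspan]
    exact (finrank_span_eq_card hlin).symm
  set G : E → (κ → ℝ) →L[ℝ] E := fun y => combination fun i => vecRep (fun x => (s (a i) x).1) x₀ y
    with hG
  set H : E → (κ → ℝ) →L[ℝ] E →L[ℝ] ℝ := fun y =>
    combination fun i => covRep (fun x => (s (a i) x).2) x₀ y with hH
  have hy₀ : e x₀ ∈ e.target := mem_extChartAt_target x₀
  have hGd : ∀ p ∈ U, p ∈ e.source → ContDiffAt ℝ ∞ G (e p) ∧ ContDiffAt ℝ ∞ H (e p) := by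
    intro p hp hpe
    have h := fun i => (hs (a i)).contDiffAt_rep hU (e.map_source hpe)
      (by rwa [e.left_inv hpe])
    exact ⟨contDiffAt_combination fun i => (h i).1, contDiffAt_combination fun i => (h i).2⟩
  have hGp : ∀ p ∈ e.source, ∀ c : κ → ℝ, G (e p) c =
      mfderiv 𝓘(ℝ, E) 𝓘(ℝ, E) e p (∑ i, c i • (s (a i) p).1) := by
    intro p hp c
    rw [hG]
    simp only [combination_apply, map_sum, map_smul]
    exact Finset.sum_congr rfl fun i _ => congrArg (c i • ·)
      (vecRep_extChartAt (fun x => (s (a i) x).1) hp)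
  have hinj : Injective (G (e x₀)) := by
    rw [injective_iff_map_eq_zero]
    intro c hc
    rw [hGp x₀ (mem_extChartAt_source x₀)] at hc
    have h0 := mfderiv_extChartAt_injective (mem_extChartAt_source x₀) (hc.trans (map_zero _).symm)
    exact funext (Fintype.linearIndependent_iff.1 hlin c h0)
  obtain ⟨θ, hθ⟩ := exists_contDiffAt_leftInverse (n := ∞)
    (hGd x₀ hx₀U (mem_extChartAt_source x₀)).1.continuousAt hinj
  -- In the chart, θ reads off the coefficients of the first argument, and H turns them into a
  -- covector applied to the second.
  refine ⟨fun p => ContinuousLinearMap.bilinearComp (E := E) (F := E) (E' := E) (F' := E)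
    ((H (e p)).comp (θ (e p)))
    (mfderiv 𝓘(ℝ, E) 𝓘(ℝ, E) e p) (mfderiv 𝓘(ℝ, E) 𝓘(ℝ, E) e p), ?_⟩
  filter_upwards [(continuousAt_extChartAt x₀).eventually hθ, hU.mem_nhds hx₀U,
    extChartAt_source_mem_nhds (I := 𝓘(ℝ, E)) x₀] with p hp hpU hpe
  refine ⟨hpe, ?_, ?_⟩
  · refine ((hGd p hpU hpe).2.clm_comp (hp.1 (hGd p hpU hpe).1)).congr_of_eventuallyEq ?_
    filter_upwards [(isOpen_target x₀).mem_nhds (e.map_source hpe)] with z hz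
    have hz' : e (e.symm z) = z := e.right_inv hz
    ext v w
    have h1 : ∀ u : E, mfderiv 𝓘(ℝ, E) 𝓘(ℝ, E) e (e.symm z)
        (mfderiv 𝓘(ℝ, E) 𝓘(ℝ, E) e.symm z u) = u := mfderiv_extChartAt_symm_apply hz
    change (H (e (e.symm z))).comp (θ (e (e.symm z)))
      (mfderiv 𝓘(ℝ, E) 𝓘(ℝ, E) e (e.symm z) (mfderiv 𝓘(ℝ, E) 𝓘(ℝ, E) e.symm z v))
      (mfderiv 𝓘(ℝ, E) 𝓘(ℝ, E) e (e.symm z) (mfderiv 𝓘(ℝ, E) 𝓘(ℝ, E) e.symm z w)) = _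
    rw [hz']
    exact congrArg₂ (fun v w => (H z).comp (θ z) v w) (h1 v) (h1 w)
  · intro α hα β hβ
    have : FiniteDimensional ℝ (TangentSpace 𝓘(ℝ, E) p) :=
      inferInstanceAs (FiniteDimensional ℝ E)
    obtain ⟨c, hc⟩ : ∃ c : κ → ℝ, α.1 = ∑ i, c i • (s (a i) p).1 := by
      have hli : LinearIndependent ℝ fun i => (s (a i) p).1 := by
        rw [Fintype.linearIndependent_iff]
        intro c hc
        have h := DFunLike.congr_fun hp.2 c
        rw [ContinuousLinearMap.comp_apply, hGp p hpe, hc] at h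
        have h0 : c = 0 := by
          rw [← (show _ = c from h)]
          exact ((θ (e p)).congr_arg (map_zero _)).trans (map_zero _)
        exact fun i => congrFun h0 i
      have hle : Submodule.span ℝ (range fun i => (s (a i) p).1) ≤ pr₁ L p := by
        rw [hpr p hpU]
        exact Submodule.span_mono (range_subset_iff.2 fun i => ⟨a i, rfl⟩)
      -- Constant rank enters here: independent vectors, as many as the rank at x₀, span pr₁(L) at p
      -- too.
      have heq := Submodule.eq_of_le_of_finrank_eq hle (by
        rw [hr p, ← hcard]
        exact finrank_span_eq_card hli)
      have hα1 : α.1 ∈ pr₁ L p := ⟨α, hα, rfl⟩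
      rw [← heq, Submodule.mem_span_range_iff_exists_fun] at hα1
      obtain ⟨c, hc⟩ := hα1
      exact ⟨c, hc.symm⟩
    rw [← linearCombination_eq_of_mem (hL.maximal_isotropic p).prop (fun i => hsL p hpU (a i))
      hα hβ hc]
    have h1 : θ (e p) (mfderiv 𝓘(ℝ, E) 𝓘(ℝ, E) e p α.1) = c := by
      rw [hc, ← hGp p hpe]
      exact DFunLike.congr_fun hp.2 c
    change H (e p) (θ (e p) (mfderiv 𝓘(ℝ, E) 𝓘(ℝ, E) e p α.1))
      (mfderiv 𝓘(ℝ, E) 𝓘(ℝ, E) e p β.1) = _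
    rw [h1]
    refine (combination_apply_apply _ _ _).trans
      (Finset.sum_congr rfl fun i _ => congrArg (c i * ·) ?_)
    exact covRep_extChartAt (fun x => (s (a i) x).2) hpe β.1

end TwoForm

/-! ### Gluing, and closure under the twisted bracket -/

section Main

open VectorField

variable {E : Type uE} [NormedAddCommGroup E] [NormedSpace ℝ E]
  {P : Type uP} [TopologicalSpace P] [ChartedSpace E P]

/-- Isotropy reads α(Y) = -β(X), so B is already antisymmetric on pr₁(L) and its alternating part
agrees with it there. -/
theorem altForm_apply_of_mem {L : PFamily E P} {B : BilField E P} {p : P}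
    (hB : B p ∈ extendingForms L p) (hL : IsIsotropic (L p)) {a b : Pontryagin E p}
    (ha : a ∈ L p) (hb : b ∈ L p) : altForm B p ![a.1, b.1] = a.2 b.1 := by
  have h := hL a ha b hb
  rw [pairing] at h
  rw [altForm_apply, hB a ha b hb, hB b hb a ha]
  linarith

theorem chartRep_neg {k : ℕ} (η : DForm E P k) (x₀ : P) :
    chartRep (fun x => -η x) x₀ = (-1 : ℝ) • chartRep η x₀ := by
  funext y
  ext v
  exact (neg_one_mul _).symm

theorem SmoothForm.neg {k : ℕ} {η : DForm E P k} (hη : SmoothForm η) :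
    SmoothForm fun x => -η x := by
  intro x₀
  rw [chartRep_neg]
  exact (hη x₀).const_smul (-1 : ℝ)

theorem extD_neg_apply {k : ℕ} (η : DForm E P k) (p : P)
    (v : Fin (k + 1) → TangentSpace 𝓘(ℝ, E) p) : extD (fun x => -η x) p v = -extD η p v := by
  change extDeriv (chartRep (fun x => -η x) p) _ _ = _
  rw [chartRep_neg]
  exact (DFunLike.congr_fun (extDeriv_smul (-1 : ℝ) (chartRep η p)) _).trans (neg_one_mul _)

variable [IsManifold 𝓘(ℝ, E) ∞ P]

/-- Smoothness on a set of a field of bilinear forms, as a section of a vector bundle. -/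
def SmoothBilFieldOn (B : BilField E P) (U : Set P) : Prop :=
  ContMDiffOn 𝓘(ℝ, E) (𝓘(ℝ, E).prod 𝓘(ℝ, E →L[ℝ] E →L[ℝ] ℝ)) ∞
    (fun x => TotalSpace.mk' (E →L[ℝ] E →L[ℝ] ℝ) (E := fun x : P =>
      TangentSpace 𝓘(ℝ, E) x →L[ℝ] TangentSpace 𝓘(ℝ, E) x →L[ℝ] ℝ) x (B x)) U

theorem exists_smoothBilFieldOn_extendingForms [FiniteDimensional ℝ E] {L : PFamily E P}
    (hL : IsAlmostDirac L) (hreg : ConstantRank (pr₁ L)) (x₀ : P) :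
    ∃ U ∈ 𝓝 x₀, ∃ B : BilField E P, SmoothBilFieldOn B U ∧ ∀ p ∈ U, B p ∈ extendingForms L p := by
  obtain ⟨B, hB⟩ := exists_local_extendingForms hL hreg x₀
  refine ⟨_, hB, B, fun p hp => ContMDiffAt.contMDiffWithinAt ?_, fun p hp => hp.2.2⟩
  obtain ⟨hp, hBp, -⟩ := hp
  obtain ⟨y, hy, rfl⟩ : ∃ y ∈ (extChartAt 𝓘(ℝ, E) x₀).target,
      (extChartAt 𝓘(ℝ, E) x₀).symm y = p :=
    ⟨_, (extChartAt 𝓘(ℝ, E) x₀).map_source hp, (extChartAt 𝓘(ℝ, E) x₀).left_inv hp⟩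
  rw [(extChartAt 𝓘(ℝ, E) x₀).right_inv hy] at hBp
  exact (contMDiffAt_bilField_iff_contDiffAt_bilRep B hy).2 hBp

set_option synthInstance.maxHeartbeats 200000 in
-- Local extensions are averaged by a smooth partition of unity; this is where the Hausdorff and
-- countability assumptions on P enter.
theorem exists_smooth_extendingForms [FiniteDimensional ℝ E] [T2Space P]
    [SecondCountableTopology P] {L : PFamily E P}
    (hL : IsAlmostDirac L) (hreg : ConstantRank (pr₁ L)) :
    ∃ B : BilField E P, (∀ x₀ : P, ∀ y ∈ (extChartAt 𝓘(ℝ, E) x₀).target,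
      ContDiffAt ℝ ∞ (bilRep B x₀) y) ∧ ∀ p, B p ∈ extendingForms L p := by
  have : LocallyCompactSpace P := Manifold.locallyCompact_of_finiteDimensional 𝓘(ℝ, E)
  have H := exists_contMDiffSection_forall_mem_convex_of_local (n := ⊤) (M := P) 𝓘(ℝ, E)
    (F_fiber := E →L[ℝ] E →L[ℝ] ℝ)
    (fun x : P => TangentSpace 𝓘(ℝ, E) x →L[ℝ] TangentSpace 𝓘(ℝ, E) x →L[ℝ] ℝ)
    (extendingForms L) (convex_extendingForms L)
  have hloc := exists_smoothBilFieldOn_extendingForms hL hreg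
  obtain ⟨B, hB⟩ := H hloc
  refine ⟨B, fun x₀ y hy => ?_, hB⟩
  exact (contMDiffAt_bilField_iff_contDiffAt_bilRep (fun x => B x) hy).1 (B.contMDiff _)

/-- Such an a is null, so L + ℝa is isotropic and maximality gives a ∈ L. Knowing that a.1 lies in
pr₁(L) avoids the dimension count behind L = L^⊥. -/
theorem mem_of_pairing_eq_zero {L : PFamily E P} (hL : IsAlmostDirac L) {p : P}
    {a : Pontryagin E p} (ha : ∀ b ∈ L p, pairing a b = 0) (ha1 : a.1 ∈ pr₁ L p) : a ∈ L p := by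
  obtain ⟨c, hc, hca⟩ := ha1
  have hca : c.1 = a.1 := hca
  have hiso := (hL.maximal_isotropic p).prop
  -- With c ∈ L over the same vector X = a.1, ⟨c, c⟩ = 0 gives c.2(X) = 0, and then ⟨a, c⟩ = 0 gives
  -- a.2(X) = 0.
  have hself : pairing a a = 0 := by
    have h1 := ha c hc
    have h2 := hiso c hc c hc
    simp only [pairing, hca] at h1 h2 ⊢
    linarith
  have hsymm : ∀ u v : Pontryagin E p, pairing u v = pairing v u := fun u v => add_comm _ _
  have hadd : ∀ u v w : Pontryagin E p, pairing (u + v) w = pairing u w + pairing v w := by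
    intro u v w
    simp only [pairing, Prod.fst_add, Prod.snd_add, map_add, add_apply]
    ring
  have hsmul : ∀ (t : ℝ) (u w : Pontryagin E p), pairing (t • u) w = t * pairing u w := by
    intro t u w
    simp only [pairing, Prod.smul_fst, Prod.smul_snd, map_smul, smul_apply,
      smul_eq_mul]
    ring
  have hsup : IsIsotropic (L p ⊔ Submodule.span ℝ {a}) := by
    intro u hu v hv
    obtain ⟨u', hu', u'', hu'', rfl⟩ := Submodule.mem_sup.1 hu
    obtain ⟨v', hv', v'', hv'', rfl⟩ := Submodule.mem_sup.1 hv
    obtain ⟨s, rfl⟩ := Submodule.mem_span_singleton.1 hu''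
    obtain ⟨t, rfl⟩ := Submodule.mem_span_singleton.1 hv''
    rw [hadd, hsmul, hsymm u', hsymm a, hadd, hadd, hsmul, hsmul, hself, hsymm a u',
      hsymm v' u', hiso u' hu' v' hv', hsymm v' a, ha v' hv', hsymm u' a, ha u' hu']
    ring
  exact (hL.maximal_isotropic p).le_of_ge hsup le_sup_left
    (Submodule.mem_sup_right (Submodule.mem_span_singleton_self a))

/-- Constant coefficients in a local frame suffice: the computation at p only sees a neighbourhood,
so no cutoff is needed. -/
theorem exists_smooth_extension_of_mem {L : PFamily E P} (hL : IsSubbundle L) {p : P}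
    {b : Pontryagin E p} (hb : b ∈ L p) :
    ∃ ρ : PSection E P, ∃ U : Set P, IsOpen U ∧ p ∈ U ∧
      ContDiffAt ℝ ∞ (vecRep (fun x => (ρ x).1) p) (extChartAt 𝓘(ℝ, E) p p) ∧
      (∀ q ∈ U, ρ q ∈ L q) ∧ ρ p = b := by
  obtain ⟨U, hU, hpU, k, s, hs, hframe⟩ := hL p
  rw [← (hframe p hpU).2, Submodule.mem_span_range_iff_exists_fun] at hb
  obtain ⟨c, hc⟩ := hb
  refine ⟨fun q => ∑ i, c i • s i q, U, hU, hpU, ?_, fun q hq => ?_, hc⟩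
  · have h : vecRep (fun x => (∑ i, c i • s i x).1) p =
        fun y => ∑ i, c i • vecRep (fun x => (s i x).1) p y := by
      funext y
      refine (congrArg (mfderiv 𝓘(ℝ, E) 𝓘(ℝ, E) (extChartAt 𝓘(ℝ, E) p)
        ((extChartAt 𝓘(ℝ, E) p).symm y)) Prod.fst_sum).trans ?_
      rw [map_sum]
      exact Finset.sum_congr rfl fun i _ => map_smul _ _ _
    rw [h]
    exact ContDiffAt.sum fun i _ => ContDiffAt.const_smul _
      ((hs i).contDiffAt_rep hU (mem_extChartAt_target p) (by rwa [extChartAt_to_inv])).1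
  · rw [← (hframe q hq).2]
    exact Submodule.sum_mem _ fun i _ => Submodule.smul_mem _ _ (Submodule.subset_span ⟨i, rfl⟩)

theorem courant_mem_of_neg_extD [FiniteDimensional ℝ E] {L : PFamily E P}
    (hL : IsAlmostDirac L) (hint : IsIntegrable (pr₁ L)) {Om : DForm E P 2} (hOm : SmoothForm Om)
    (hOmL : ∀ p, ∀ a ∈ L p, ∀ b ∈ L p, Om p ![a.1, b.1] = a.2 b.1)
    {φ : DForm E P 3} (hφ : SmoothForm φ)
    (hφOm : ∀ p (v : Fin 3 → TangentSpace 𝓘(ℝ, E) p), φ p v = - extD Om p v)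
    {σ τ : PSection E P} (hσ : σ ∈ Gam L) (hτ : τ ∈ Gam L) : courant φ σ τ ∈ Gam L := by
  have : CompleteSpace E := FiniteDimensional.complete ℝ E
  refine ⟨smoothSectionOn_courant hφ hσ.1 hτ.1, fun p => ?_⟩
  have hp := mem_extChartAt_target (I := 𝓘(ℝ, E)) p
  have hps := mem_extChartAt_source (I := 𝓘(ℝ, E)) p
  set e := extChartAt 𝓘(ℝ, E) p with he
  obtain ⟨hX, ha⟩ := hσ.1.contDiffAt_rep isOpen_univ hp (mem_univ _)
  obtain ⟨hY, hb⟩ := hτ.1.contDiffAt_rep isOpen_univ hp (mem_univ _)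
  have hpr : ∀ {ρ : PSection E P} {q : P}, ρ q ∈ L q → (ρ q).1 ∈ pr₁ L q :=
    fun h => ⟨_, h, rfl⟩
  have hXF : ∀ᶠ q in 𝓝 p, (σ q).1 ∈ pr₁ L q := .of_forall fun q => hpr (hσ.2 q)
  have hYF : ∀ᶠ q in 𝓝 p, (τ q).1 ∈ pr₁ L q := .of_forall fun q => hpr (hτ.2 q)
  have hXY := mlieBracket_mem_of_isIntegrable hint hX hY hXF hYF
  -- Involutivity settles the vector part. It remains to pair the bracket with an arbitrary element
  -- of the fibre, extended to a local section ρ so that derivatives make sense.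
  refine mem_of_pairing_eq_zero hL (fun b₀ hb₀ => ?_) hXY
  obtain ⟨ρ, U, hU, hpU, hZ, hρ, rfl⟩ := exists_smooth_extension_of_mem hL.subbundle hb₀
  have hZF : ∀ᶠ q in 𝓝 p, (ρ q).1 ∈ pr₁ L q := by
    filter_upwards [hU.mem_nhds hpU] with q hq
    exact hpr (hρ q hq)
  have hXZ := mlieBracket_mem_of_isIntegrable hint hX hZ hXF hZF
  have hYZ := mlieBracket_mem_of_isIntegrable hint hY hZ hYF hZF
  have hbr : ∀ {V W : VField E P}, ContDiffAt ℝ ∞ (vecRep V p) (e p) →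
      ContDiffAt ℝ ∞ (vecRep W p) (e p) →
      lieBracket ℝ (vecRep V p) (vecRep W p) (e p) =
        mfderiv 𝓘(ℝ, E) 𝓘(ℝ, E) e p (mlieBracket 𝓘(ℝ, E) V W p) := fun hV hW => by
    rw [← vecRep_mlieBracket hp hV hW, vecRep_extChartAt _ hps]
  -- In the chart, sections of `L` satisfy the equation of the graph of `Om`.
  have hgraph : ∀ (μ : PSection E P) (q : P), q ∈ e.source → μ q ∈ L q → ∀ w ∈ pr₁ L q,
      covRep (fun x => (μ x).2) p (e q) (mfderiv 𝓘(ℝ, E) 𝓘(ℝ, E) e q w) =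
        chartRep Om p (e q) ![vecRep (fun x => (μ x).1) p (e q),
          mfderiv 𝓘(ℝ, E) 𝓘(ℝ, E) e q w] := by
    rintro μ q hq hμ _ ⟨d, hd, rfl⟩
    rw [covRep_extChartAt (fun x => (μ x).2) hq, vecRep_extChartAt (fun x => (μ x).1) hq]
    refine (hOmL q _ hμ d hd).symm.trans ?_
    refine (chartRep_apply_mfderiv Om hq _).symm.trans ?_
    refine congrArg (chartRep Om p (e q)) (funext fun i => ?_)
    fin_cases i <;> rfl
  have hgraph' : ∀ μ ν : PSection E P, (∀ᶠ q in 𝓝 p, μ q ∈ L q) → (∀ᶠ q in 𝓝 p, ν q ∈ L q) →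
      ∀ᶠ z in 𝓝 (e p), covRep (fun x => (μ x).2) p z (vecRep (fun x => (ν x).1) p z) =
        chartRep Om p z ![vecRep (fun x => (μ x).1) p z, vecRep (fun x => (ν x).1) p z] := by
    intro μ ν hμ hν
    have hc : Filter.Tendsto e.symm (𝓝 (e p)) (𝓝 p) := by
      have h := continuousAt_extChartAt_symm (I := 𝓘(ℝ, E)) p
      rwa [ContinuousAt, extChartAt_to_inv] at h
    filter_upwards [(isOpen_target p).mem_nhds hp, hc.eventually hμ, hc.eventually hν]
      with z hz hμz hνz
    have h := hgraph μ (e.symm z) (e.map_target hz) hμz _ (hpr hνz)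
    rw [← vecRep_extChartAt (fun x => (ν x).1) (e.map_target hz), e.right_inv hz] at h
    exact h
  have hσL : ∀ᶠ q in 𝓝 p, σ q ∈ L q := .of_forall hσ.2
  have hτL : ∀ᶠ q in 𝓝 p, τ q ∈ L q := .of_forall hτ.2
  have hρL : ∀ᶠ q in 𝓝 p, ρ q ∈ L q := Filter.eventually_of_mem (hU.mem_nhds hpU) hρ
  have key := courant_pairing_eq_extDeriv (c := covRep (fun x => (ρ x).2) p (e p))
    ((hOm.contDiffAt hp).differentiableAt (by simp)) (hX.differentiableAt (by simp))
    (hY.differentiableAt (by simp)) (hZ.differentiableAt (by simp))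
    (ha.differentiableAt (by simp)) (hb.differentiableAt (by simp))
    (hgraph' τ ρ hτL hρL) (hgraph' σ τ hσL hτL) (hgraph' σ ρ hσL hρL)
    (by rw [hbr hX hZ]; exact hgraph τ p hps (hτ.2 p) _ hXZ)
    (by rw [hbr hY hZ]; exact hgraph σ p hps (hσ.2 p) _ hYZ)
    (by rw [hbr hX hY]; exact hgraph ρ p hps (hρ p hpU) _ hXY)
  have hφe : ∀ v, chartRep φ p (e p) v = - extDeriv (chartRep Om p) (e p) v := fun v => by
    rw [← chartRep_extD hOm hp]
    exact hφOm _ _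
  have h1 : (courant φ σ τ p).2 (ρ p).1 = covRep (fun x => (courant φ σ τ x).2) p (e p)
      (vecRep (fun x => (ρ x).1) p (e p)) := by
    rw [vecRep_extChartAt (fun x => (ρ x).1) hps]
    exact (covRep_extChartAt (fun x => (courant φ σ τ x).2) hps _).symm
  have h2 : (ρ p).2 (courant φ σ τ p).1 = covRep (fun x => (ρ x).2) p (e p)
      (lieBracket ℝ (vecRep (fun x => (σ x).1) p) (vecRep (fun x => (τ x).1) p) (e p)) := by
    rw [hbr hX hY]
    exact (covRep_extChartAt (fun x => (ρ x).2) hps _).symm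
  have h3 : insertTwo (vecRep (fun x => (τ x).1) p (e p))
      (ContinuousAlternatingMap.curryLeft (chartRep φ p (e p))
        (vecRep (fun x => (σ x).1) p (e p))) (vecRep (fun x => (ρ x).1) p (e p)) =
      - extDeriv (chartRep Om p) (e p) ![vecRep (fun x => (σ x).1) p (e p),
        vecRep (fun x => (τ x).1) p (e p), vecRep (fun x => (ρ x).1) p (e p)] := by
    rw [insertTwo_apply, ← hφe]
    rfl
  rw [pairing, h1, h2, covRep_courant hσ.1 hτ.1 hp]
  simp only [add_apply, sub_apply]
  -- The twist contributes -dOm(X, Y, Z), which cancels the untwisted pairing computed in `key`.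
  rw [h3, insertTwo_apply, insertTwo_apply, ← key]
  simp only [chartRep_toForm]
  ring

end Main

end DiracGeometry

end

theorem mainTheorem1 {E : Type*} [NormedAddCommGroup E] [NormedSpace ℝ E] [FiniteDimensional ℝ E]
    {P : Type*} [TopologicalSpace P] [T2Space P] [SecondCountableTopology P]
    [ChartedSpace E P] [IsManifold 𝓘(ℝ, E) ∞ P]
    (L : DiracGeometry.PFamily E P)
    (hL : DiracGeometry.IsAlmostDirac L)
    (hreg : DiracGeometry.ConstantRank (DiracGeometry.pr₁ L))
    (hint : DiracGeometry.IsIntegrable (DiracGeometry.pr₁ L)) :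
    ∃ φ : DiracGeometry.DForm E P 3,
      DiracGeometry.IsExactForm φ ∧ DiracGeometry.IsTwistedDirac φ L := by
  obtain ⟨B, hBs, hB⟩ := DiracGeometry.exists_smooth_extendingForms hL hreg
  have hOm : DiracGeometry.SmoothForm (DiracGeometry.altForm B) :=
    DiracGeometry.smoothForm_altForm hBs
  -- The sign is forced: the untwisted bracket pairs to +dOm, so Ω is minus the extension of ω.
  refine ⟨DiracGeometry.extD fun x => -DiracGeometry.altForm B x, ⟨_, hOm.neg, rfl⟩,
    DiracGeometry.smoothForm_extD hOm.neg, DiracGeometry.extD_extD hOm.neg, hL,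
    fun σ hσ τ hτ => ?_⟩
  exact DiracGeometry.courant_mem_of_neg_extD hL hint hOm
    (fun p a ha b hb => DiracGeometry.altForm_apply_of_mem (hB p)
      (hL.maximal_isotropic p).prop ha hb)
    (DiracGeometry.smoothForm_extD hOm.neg) (fun p v => DiracGeometry.extD_neg_apply _ p v) hσ hτ
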